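/- Let $\zeta$ be a parameter, and put $$G(x,y)=(\zeta+2)xy(x+y)-\zeta(x^2+y^2)-2(\zeta^2+3\zeta+1)xy+\zeta(2\zeta+1)(x+y),$$ $$\xi_0=2\zeta+1,\quad \xi_1=\frac{\zeta}{\zeta+2},\quad \xi_2=\frac{\zeta(2\zeta+1)}{\zeta+2},\quad \xi_3=1.$$ For integers $N\ge 0$ and $0\le p\le 2N$ let $$T(x_1,\dots,x_p;x_{p+1},\dots,x_{2N})=\frac{\det_{1\le i,j\le 2N}(A_{ij})}{\prod_{1\le i<j\le p}(x_j-x_i)\prod_{p+1\le i<j\le 2N}(x_j-x_i)},\qquad A_{ij}=\begin{cases}P_j(x_i),& i\le p,\\ (\hat\sigma P_j)(x_i),& i>p,\end{cases}$$ where $P_j(x)=x^{j-1}(x-2\zeta-1)^{\lfloor (j-1)/2\rfloor}\big((\zeta+2)x-\zeta\big)^{N-\lfloor (j+1)/2\rfloor}$, and where $\hat\sigma P_j$ equals $\big((\zeta+2)x-\zeta\big)(2\zeta+1-3x)\,P_j(x)$ for $j$ odd and $(x-2\zeta-1)\big((\zeta+2)x-3\zeta\big)\,P_j(x)$ for $j$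 even. This $T$ is a polynomial in $x_1,\dots,x_{2N}$ and $\zeta$ (with $T=1$ if $N=0$), so it may be evaluated at coinciding arguments. Let $n\in\mathbb Z$ and $\mathbf k=(k_0,k_1,k_2,k_3)\in\mathbb Z^4$ be such that $m=2n-|\mathbf k|\ge 0$, where $|\mathbf k|=\sum_jk_j$. Write $k_j^\pm=\max(\pm k_j,0)$, and for $\mathbf a\in\mathbb Z_{\ge 0}^4$ let $\boldsymbol\xi^{\mathbf a}$ be the sequence in which $\xi_0,\xi_1,\xi_2,\xi_3$ are repeated $a_0,a_1,a_2,a_3$ times. Define the rational function $T_n^{(\mathbf k)}$ of $x_1,\dots,x_m$ and $\zeta$ (symmetric in the $x_j$) by $$T_n^{(\mathbf k)}(x_1,\dots,x_m)=\frac{(-1)^{\binom{|\mathbf k^-|}2}\,T(x_1,\dots,x_m,\boldsymbol\xi^{\mathbf k^+};\boldsymbol\xi^{\mathbf k^-})}{2^{|\mathbf k^-|}\prod_{i,j=0}^3G(\xi_i,\xi_j)^{k_i^-k_j^+}\prod_{j=1}^m\prod_{i=0}^3G(x_j,\xi_i)^{k_i^-}}.$$ Then, for all such $n$ and $\mathbf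 k$, the limit $$\lim_{\zeta\to-2}\left(\frac{\zeta+2}6\right)^{(k_1+k_2)(n-1)-\lfloor (k_1+k_2-1)^2/4\rfloor}T_n^{(\mathbf k)}(x_1,\dots,x_m)$$ exists for all $x_1,\dots,x_m\in\mathbb C$ (with $x_j\ne 0$ for all $j$ if $k_0<0$, and $x_j\ne -2$ for all $j$ if $k_3<0$), and, as a function of $x_1,\dots,x_m$, it is not identically zero. Consequently, the rational function $T_n^{(\mathbf k)}\in\mathbb C(\zeta,x_1,\dots,x_m)$ is not identically zero. -/

import Mathlib

open Filter Topology

namespace ThetaT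

/-! ### The basic polynomials

Everything in this section makes sense in an arbitrary commutative ring, with a parameter `ζ`. -/

section Basic

variable {R : Type*} [CommRing R]

/-- The symmetric polynomial `G(x, y)`. -/
def G (ζ x y : R) : R :=
  (ζ + 2) * x * y * (x + y) - ζ * (x ^ 2 + y ^ 2) - 2 * (ζ ^ 2 + 3 * ζ + 1) * x * y
    + ζ * (2 * ζ + 1) * (x + y)

/-- The basis polynomials, `P N ζ j x` being `P_{j+1}(x)` (the index `j` is counted from `0`),
where `0 ≤ j < 2 N`:
`P_j(x) = x^{j-1} (x-2ζ-1)^{⌊(j-1)/2⌋} ((ζ+2)x-ζ)^{N-⌊(j+1)/2⌋}` for `1 ≤ j ≤ 2N`. -/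
def P (N : ℕ) (ζ : R) (j : ℕ) (x : R) : R :=
  x ^ j * (x - 2 * ζ - 1) ^ (j / 2) * ((ζ + 2) * x - ζ) ^ (N - (j + 2) / 2)

def e₀ (ζ x : R) : R := ((ζ + 2) * x - ζ) * (2 * ζ + 1 - 3 * x)

def e₁ (ζ x : R) : R := (x - 2 * ζ - 1) * ((ζ + 2) * x - 3 * ζ)

/-- The image of `P_{j+1}` under the operator `σ̂`; the index `j` is counted from `0`, so that
`e₀` goes with even `j`. -/
def sigmaP (N : ℕ) (ζ : R) (j : ℕ) (x : R) : R :=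
  if Even j then e₀ ζ x * P N ζ j x else e₁ ζ x * P N ζ j x

/-- The matrix with rows `(P_j(x_i))_j` for the first `p` indices `i` and `(σ̂ P_j (x_i))_j` for
the remaining ones. -/
def A (N p : ℕ) (ζ : R) (x : Fin (2 * N) → R) : Matrix (Fin (2 * N)) (Fin (2 * N)) R :=
  Matrix.of fun i j => if (i : ℕ) < p then P N ζ j (x i) else sigmaP N ζ j (x i)

/-- Pairs `i < j` of indices which are both among the first `p` indices, or both among the
remaining ones. -/
def pairs (N p : ℕ) : Finset (Fin (2 * N) × Fin (2 * N)) :=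
  Finset.univ.filter fun a => a.1 < a.2 ∧ ((a.2 : ℕ) < p ∨ p ≤ (a.1 : ℕ))

/-- The product `Δ(x_1, …, x_p) Δ(x_{p+1}, …, x_{2N})` of two Vandermonde products
`Δ(x) = ∏_{i<j} (x_j - x_i)`. -/
def Vand (N p : ℕ) (x : Fin (2 * N) → R) : R :=
  ∏ a ∈ pairs N p, (x a.2 - x a.1)

theorem sub_dvd_det (N p : ℕ) (ζ : R) (x : Fin (2 * N) → R) (a : Fin (2 * N) × Fin (2 * N))
    (ha : a ∈ pairs N p) : x a.2 - x a.1 ∣ (A N p ζ x).det := by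
  obtain ⟨i, j⟩ := a
  simp only [pairs, Finset.mem_filter, Finset.mem_univ, true_and] at ha
  obtain ⟨hij, hp⟩ := ha
  simp only
  set I : Ideal R := Ideal.span {x j - x i} with hI
  have hX : Ideal.Quotient.mk I (x j) = Ideal.Quotient.mk I (x i) :=
    Ideal.Quotient.eq.2 (Ideal.mem_span_singleton_self _)
  rw [← Ideal.mem_span_singleton, ← hI, ← Ideal.Quotient.eq_zero_iff_mem, RingHom.map_det]
  refine Matrix.det_zero_of_row_eq hij.ne ?_
  funext c
  have h2 : ((i : ℕ) < p ↔ (j : ℕ) < p) := by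
    have : (i : ℕ) < (j : ℕ) := hij
    omega
  by_cases h : (j : ℕ) < p
  · simp [A, h2, h, P, hX]
  · by_cases hc : Even (c : ℕ)
    · simp [A, h2, h, P, sigmaP, hc, e₀, hX]
    · simp [A, h2, h, P, sigmaP, hc, e₁, hX]

end Basic

/-! ### The polynomials `T(x_1, …, x_p; x_{p+1}, …, x_{2N})` -/

section Tpoly

open MvPolynomial

/-- Polynomials over `ℤ[ζ]` in the variables `x_1, …, x_{2N}`. -/
abbrev PolyRing (N : ℕ) : Type := MvPolynomial (Fin (2 * N)) (Polynomial ℤ)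

/-- The element `ζ` of `ℤ[ζ][x_1, …, x_{2N}]`. -/
noncomputable def zetaVar (N : ℕ) : PolyRing N := C Polynomial.X

theorem X_sub_X_dvd_det (N p : ℕ) (a : Fin (2 * N) × Fin (2 * N)) (ha : a ∈ pairs N p) :
    (X a.2 - X a.1 : PolyRing N) ∣ (A N p (zetaVar N) X).det :=
  sub_dvd_det N p _ _ a ha

theorem irreducible_X_sub_X {N : ℕ} {i j : Fin (2 * N)} (hij : i ≠ j) :
    Irreducible (X j - X i : PolyRing N) := by
  classical
  have hci : coeff (Finsupp.single j 1) (X j - X i : PolyRing N) = 1 := by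
    simp [coeff_X, Finsupp.single_left_inj, hij]
  have hne : (X j - X i : PolyRing N) ≠ 0 := by
    intro h
    rw [h] at hci
    simp at hci
  refine irreducible_of_totalDegree_eq_one ?_ ?_
  · apply le_antisymm
    · exact (totalDegree_sub _ _).trans (by simp)
    · have := le_totalDegree (p := (X j - X i : PolyRing N)) (s := Finsupp.single j 1)
        (by rw [mem_support_iff, hci]; exact one_ne_zero)
      simpa using this
  · intro r hr
    have := hr (Finsupp.single j 1)
    rw [hci] at this
    exact isUnit_of_dvd_one this

theorem isRelPrime_X_sub_X (N p : ℕ) {a b : Fin (2 * N) × Fin (2 * N)} (ha : a ∈ pairs N p)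
    (hb : b ∈ pairs N p) (hab : a ≠ b) :
    IsRelPrime (X a.2 - X a.1 : PolyRing N) (X b.2 - X b.1) := by
  classical
  obtain ⟨i, j⟩ := a
  obtain ⟨c, d⟩ := b
  simp only [pairs, Finset.mem_filter, Finset.mem_univ, true_and] at ha hb
  have hij : i < j := ha.1
  have hcd : c < d := hb.1
  refine (irreducible_X_sub_X hij.ne).isRelPrime_iff_not_dvd.2 ?_
  rintro ⟨q, hq⟩
  have key : ∀ f : Fin (2 * N) → Polynomial ℤ, f i = f j → f c = f d := by
    intro f hf
    have := congrArg (eval f) hq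
    simp only [map_sub, eval_X, map_mul, hf, sub_self, zero_mul] at this
    exact (sub_eq_zero.1 this).symm
  by_cases hc : c = i ∨ c = j
  · by_cases hd : d = i ∨ d = j
    · apply hab
      rcases hc with rfl | rfl <;> rcases hd with rfl | rfl
      · exact absurd hcd (lt_irrefl _)
      · rfl
      · exact absurd hij hcd.asymm
      · exact absurd hcd (lt_irrefl _)
    · push Not at hd
      have := key (fun t => if t = d then 1 else 0) (by simp [hd.1.symm, hd.2.symm])
      simp [hcd.ne] at this
  · push Not at hc
    have := key (fun t => if t = c then 1 else 0) (by simp [hc.1.symm, hc.2.symm])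
    simp [hcd.ne'] at this

/-- The determinant is divisible by the product of the two Vandermonde products. -/
theorem Vand_dvd_det (N p : ℕ) :
    (Vand N p X : PolyRing N) ∣ (A N p (zetaVar N) X).det :=
  Finset.prod_dvd_of_isRelPrime
    (fun _ ha _ hb hab => isRelPrime_X_sub_X N p ha hb hab)
    (fun a ha => X_sub_X_dvd_det N p a ha)

/-- The polynomial `T(x_1, …, x_p; x_{p+1}, …, x_{2N})` over `ℤ[ζ]`: the quotient of the
determinant `det (A_{ij})` by `Δ(x_1, …, x_p) Δ(x_{p+1}, …, x_{2N})`. -/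
noncomputable def Tpoly (N p : ℕ) : PolyRing N := (Vand_dvd_det N p).choose

theorem Vand_mul_Tpoly (N p : ℕ) :
    (Vand N p X : PolyRing N) * Tpoly N p = (A N p (zetaVar N) X).det :=
  (Vand_dvd_det N p).choose_spec.symm

theorem Vand_ne_zero (N p : ℕ) : (Vand N p X : PolyRing N) ≠ 0 := by
  refine Finset.prod_ne_zero_iff.2 fun a ha => ?_
  simp only [pairs, Finset.mem_filter] at ha
  exact (irreducible_X_sub_X (ne_of_lt ha.2.1)).ne_zero

/-- The value of `T(x_1, …, x_p; x_{p+1}, …, x_{2N})` at a point `x` and a value of `ζ` in a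
commutative ring. -/
noncomputable def T {K : Type*} [CommRing K] (N p : ℕ) (ζ : K) (x : Fin (2 * N) → K) : K :=
  eval₂ (Polynomial.eval₂RingHom (Int.castRingHom K) ζ) x (Tpoly N p)

end Tpoly

/-! ### The functions `T_n^{(k)}` -/

section Tnk

variable {K : Type*} [Field K]

/-- The four special values `ξ_0, ξ_1, ξ_2, ξ_3`. -/
def xi (ζ : K) : Fin 4 → K :=
  ![2 * ζ + 1, ζ / (ζ + 2), ζ * (2 * ζ + 1) / (ζ + 2), 1]

/-- `k_j⁺ = max (k_j, 0)`. -/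
def kpos (k : Fin 4 → ℤ) (j : Fin 4) : ℕ := (k j).toNat

/-- `k_j⁻ = max (-k_j, 0)`. -/
def kneg (k : Fin 4 → ℤ) (j : Fin 4) : ℕ := (-k j).toNat

/-- The list `ξ_0, …, ξ_0, ξ_1, …, ξ_1, ξ_2, …, ξ_2, ξ_3, …, ξ_3`, where `ξ_j` is repeated `a_j`
times. -/
def xiList (ζ : K) (a : Fin 4 → ℕ) : List K :=
  (List.finRange 4).flatMap fun j => List.replicate (a j) (xi ζ j)

/-- The list `x_1, …, x_m, ξ^{k⁺}, ξ^{k⁻}`. -/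
def args {m : ℕ} (k : Fin 4 → ℤ) (ζ : K) (x : Fin m → K) : List K :=
  List.ofFn x ++ xiList ζ (kpos k) ++ xiList ζ (kneg k)

/-- The value of `T_n^{(k)}(x_1, …, x_m)` at a value of `ζ` and a point `x` with coordinates in a
field, for `m = 2n - |k| ≥ 0`. The number `m + |k⁺| + |k⁻|` of arguments of `T` is then
`2 (n + |k⁻|)`. -/
noncomputable def Tn {m : ℕ} (n : ℤ) (k : Fin 4 → ℤ) (ζ : K) (x : Fin m → K) : K :=
  (-1) ^ ((∑ j, kneg k j).choose 2)
      * T (n + ∑ j, kneg k j).toNat (m + ∑ j, kpos k j) ζ (fun i => (args k ζ x).getD i 0)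
    / (2 ^ (∑ j, kneg k j)
      * (∏ i, ∏ j, G ζ (xi ζ i) (xi ζ j) ^ (kneg k i * kpos k j))
      * ∏ j, ∏ i, G ζ (x j) (xi ζ i) ^ (kneg k i))

/-- The field `ℂ(ζ, x_1, …, x_m)` of rational functions; `none` indexes the variable `ζ` and
`some j` the variable `x_j`. -/
abbrev RatField (m : ℕ) : Type := FractionRing (MvPolynomial (Option (Fin m)) ℂ)

/-- `T_n^{(k)}` as a rational function, that is, as an element of `ℂ(ζ, x_1, …, x_m)`. -/
noncomputable def TnRat (m : ℕ) (n : ℤ) (k : Fin 4 → ℤ) : RatField m :=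
  Tn n k (algebraMap (MvPolynomial (Option (Fin m)) ℂ) (RatField m) (MvPolynomial.X none))
    (fun j : Fin m =>
      algebraMap (MvPolynomial (Option (Fin m)) ℂ) (RatField m) (MvPolynomial.X (some j)))

/-- The exponent `(k_1 + k_2)(n - 1) - δ(k_1 + k_2 - 1)`, where `δ(N) = ⌊N²/4⌋`. -/
def trigExp (n : ℤ) (k : Fin 4 → ℤ) : ℤ :=
  (k 1 + k 2) * (n - 1) - (k 1 + k 2 - 1) ^ 2 / 4

/-- The points `x` at which the limit `ζ → -2` is considered: no `x_j` is at a limit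
`0 = lim η_0` or `-2 = lim η_3` of a pole of `T_n^{(k)}`. -/
def Admissible {m : ℕ} (k : Fin 4 → ℤ) (x : Fin m → ℂ) : Prop :=
  ∀ j, (k 0 < 0 → x j ≠ 0) ∧ (k 3 < 0 → x j ≠ -2)

end Tnk

end ThetaT

/-!
As `ζ → -2`, the points `ξ₁` and `ξ₂` tend to infinity like `1 / (ζ + 2)`, with
`(ζ + 2) ξ₁ → -2` and `(ζ + 2) ξ₂ → 6`, whereas `ξ₀ → -3` and `ξ₃ = 1` stay bounded. The proof
separates the two scales and shows that what remains on each of them is nondegenerate.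

*Coinciding points and the two scales.* Give two arguments of `T` the same label if they lie on the
same side of the semicolon and have the same size. Newton interpolation within each label
(`det_eval_eq`) cancels the corresponding factors of the two Vandermonde products and replaces the
entries of the matrix by divided differences, which make sense at coinciding points
(`T_mul_mixedVand`). After rescaling the large points by `ζ + 2` and moving powers of `ζ + 2` out of
rows and columns (`T_mul_scaledVand`), the matrix is polynomial in `ζ` and the `x_j`, and it is
block triangular at `ζ = -2`. Counting the powers of `ζ + 2`, including those from the values of
`G`, gives the exponent of the theorem (`exponent_eq`), so that `T_n^{(k)}` is this power times a
quotient `tnNum / tnDen` of polynomials (`Tn_eq`). It remains to see that at `ζ = -2` the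
denominator vanishes only at the excluded points (`tnDen_neg_two_ne_zero`), and that the numerator
is not identically zero (`exists_tnNum_neg_two_ne_zero`). The rational function is then nonzero,
since its numerator and denominator have a common point where neither vanishes.

*The two blocks.* A vector in the kernel of a block is a combination of limit polynomials such that
it or its image under `σ̂` vanishes to prescribed orders (`det_scaledMatrix_ne_zero`). For the small
points the limit polynomials are `trigP i = xⁱ (x + 3)^⌊i/2⌋`, and the zeros are at `1` and `-3`, in
addition to the `x_j`. As the `x_j` are free, a dimension count removes them
(`exists_small_points`). The substitution `x ↦ 6 / x` turns the large block into the same problem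
(`eq_zero_of_rowPoly_large_dvd`). The problem is trigonometric: for `x = 2 cos θ - 1`, the span of
the first `n` polynomials `trigP i` is that of `n` consecutive functions `sin (κ θ) / sin θ` with
`κ ≡ 1` modulo `3`, and `σ̂` sends such a function to `-2 cos (κ θ)` (`trigPair_mem`). These
Chebyshev polynomials are eigenvectors, with eigenvalue `κ²`, of second order operators which are
singular at `cos θ = ±1`, so that vanishing there to order `b` forces `b` moments of the
coefficients, alternating at `-1`, to be zero (`moments_of_pow_dvd`). The determinant of these
moments is, after removal of obvious factors, an integer which is nonzero modulo `3`, because there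
all `κ` become `1` (`det_momentMatrix_ne_zero`). This last step covers all combinations of vanishing
orders and signs at once (`eq_zero_of_trigP_dvd`).
-/

namespace ThetaT

/-! ### Moments over an arithmetic progression of difference three -/

section Window

open Polynomial Finset

/-- The Taylor coefficients of `∑ dᵢ Yⁱ` at a square root of unity `r` are, up to a power of `r`,
the binomial moments `∑ dᵢ (i choose l) rⁱ`. -/
theorem X_sub_C_pow_dvd_of_moments {F : Type*} [CommRing F] (n b : ℕ) (r : F) (hr : r * r = 1)
    (d : ℕ → F) (h : ∀ l < b, ∑ i ∈ range n, d i * (r ^ i * (i.choose l : F)) = 0) :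
    (X - C r) ^ b ∣ ∑ i ∈ range n, C (d i) * X ^ i := by
  rw [X_sub_C_pow_dvd_iff, ← taylor_apply, X_pow_dvd_iff]
  intro l hl
  rw [taylor_coeff, map_sum, eval_finsetSum]
  have h' := congrArg (r ^ l * ·) (h l hl)
  simp only [mul_zero, mul_sum] at h'
  rw [← h']
  refine sum_congr rfl fun i _ => ?_
  rw [C_mul_X_pow_eq_monomial, hasseDeriv_monomial, eval_monomial]
  rcases lt_or_ge i l with hil | hil
  · simp [Nat.choose_eq_zero_of_lt hil]
  · obtain ⟨e, rfl⟩ := Nat.exists_eq_add_of_le hil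
    have : r ^ l * r ^ (l + e) = r ^ e := by
      rw [pow_add, ← mul_assoc, ← mul_pow, hr, one_pow, one_mul]
    rw [Nat.add_sub_cancel_left, ← this]
    ring

/-- If `2` is invertible, a sequence on `a + b` consecutive integers is determined by its first
`b` binomial moments and by the first `a` binomial moments of its alternating version: otherwise
`(Y - 1)ᵇ (Y + 1)ᵃ` would divide a nonzero polynomial of degree less than `a + b`. -/
theorem eq_zero_of_alternating_moments {F : Type*} [Field F] (h2 : (2 : F) ≠ 0) (a b : ℕ)
    (d : ℕ → F) (h1 : ∀ l < b, ∑ i ∈ range (a + b), d i * (i.choose l : F) = 0)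
    (h3 : ∀ l < a, ∑ i ∈ range (a + b), d i * ((-1) ^ i * (i.choose l : F)) = 0) :
    ∀ i < a + b, d i = 0 := by
  have e1 := X_sub_C_pow_dvd_of_moments (a + b) b (1 : F) (by ring) d (by simpa using h1)
  have e3 := X_sub_C_pow_dvd_of_moments (a + b) a (-1 : F) (by ring) d h3
  set f := ∑ i ∈ range (a + b), C (d i) * X ^ i with hf
  have hco : IsCoprime ((X - C (-1 : F)) ^ a) ((X - C (1 : F)) ^ b) := by
    refine IsCoprime.pow (isCoprime_X_sub_C_of_isUnit_sub ?_)
    refine IsUnit.mk0 _ fun h => h2 ?_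
    linear_combination -h
  have hdvd := hco.mul_dvd e3 e1
  have hf0 : f = 0 := by
    by_contra hne
    have hdeg := natDegree_le_of_dvd hdvd hne
    rw [Monic.natDegree_mul ((monic_X_sub_C _).pow _) ((monic_X_sub_C _).pow _),
      natDegree_pow, natDegree_pow, natDegree_X_sub_C, natDegree_X_sub_C] at hdeg
    have hlt : f.natDegree < a + b := by
      rw [natDegree_lt_iff_degree_lt hne]
      refine (degree_sum_le _ _).trans_lt ?_
      rw [Finset.sup_lt_iff (by exact_mod_cast WithBot.bot_lt_coe _)]
      intro i hi
      refine (degree_C_mul_X_pow_le _ _).trans_lt ?_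
      exact_mod_cast mem_range.1 hi
    omega
  intro i hi
  have := congrArg (fun p => p.coeff i) hf0
  simpa [hf, coeff_X_pow, finsetSum_coeff, hi] using this

/-- The integers congruent to `1` modulo `3`, read from `3 j₀ + 1` upwards. -/
def kappa (j₀ : ℤ) (i : ℕ) : ℤ := 3 * (i + j₀) + 1

/-- The quotient of `∏_{s<l} (κ_i² - κ_s²)` by `3ˡ l! (i choose l)`, which is congruent to `2ˡ`
modulo `3`. -/
def kappaUnit (j₀ : ℤ) (l i : ℕ) : ℤ := ∏ s ∈ range l, (3 * (i + s + 2 * j₀) + 2)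

theorem prod_kappa_sq_sub (j₀ : ℤ) (l i : ℕ) :
    ∏ s ∈ range l, (kappa j₀ i ^ 2 - kappa j₀ s ^ 2)
      = 3 ^ l * l.factorial * (i.choose l * kappaUnit j₀ l i) := by
  have h1 : ((i.descFactorial l : ℕ) : ℤ) = ∏ s ∈ range l, ((i : ℤ) - s) := by
    rcases lt_or_ge i l with h | h
    · rw [Nat.descFactorial_of_lt h, eq_comm]
      exact prod_eq_zero (mem_range.2 h) (by simp)
    · rw [Nat.descFactorial_eq_prod_range, Nat.cast_prod]
      refine prod_congr rfl fun s hs => ?_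
      have := mem_range.1 hs
      rw [Nat.cast_sub (by omega)]
  have h2 : ∀ s ∈ range l, kappa j₀ i ^ 2 - kappa j₀ s ^ 2
      = 3 * ((i - s) * (3 * (i + s + 2 * j₀) + 2)) := fun s _ => by
    simp only [kappa]
    ring
  rw [prod_congr rfl h2, prod_mul_distrib, prod_mul_distrib, ← h1,
    Nat.descFactorial_eq_factorial_mul_choose, prod_const, card_range, kappaUnit]
  push_cast
  ring

/-- The matrix of the moments `κ^s ∏_{t<l} (κ² - κ_t²)` and of their alternating versions, after
division of each row by its common factor `3ˡ l!`. -/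
def momentMatrix (a b : ℕ) (j₀ : ℤ) (s t : ℕ) : Matrix (Fin (a + b)) (Fin (a + b)) ℤ :=
  Matrix.of fun r i => if (r : ℕ) < b then kappa j₀ i ^ s * ((i : ℕ).choose r * kappaUnit j₀ r i)
    else (-1) ^ (i : ℕ) * kappa j₀ i ^ t * ((i : ℕ).choose (r - b) * kappaUnit j₀ (r - b) i)

/-- Modulo `3` all `κ` are `1`, so that the entries become binomial coefficients up to signs and
powers of `2`. -/
theorem det_momentMatrix_ne_zero (a b : ℕ) (j₀ : ℤ) (s t : ℕ) :
    (momentMatrix a b j₀ s t).det ≠ 0 := by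
  intro h0
  have h2 : (2 : ZMod 3) ≠ 0 := by decide
  have h3 : (3 : ZMod 3) = 0 := by decide
  have : Fact (Nat.Prime 3) := ⟨Nat.prime_three⟩
  have hk : ∀ i, ((kappa j₀ i : ℤ) : ZMod 3) = 1 := fun i => by simp [kappa, h3]
  have hu : ∀ l i, ((kappaUnit j₀ l i : ℤ) : ZMod 3) = 2 ^ l := fun l i => by
    simp [kappaUnit, h3]
  have h0' : ((Int.castRingHom (ZMod 3)).mapMatrix (momentMatrix a b j₀ s t)).det = 0 := by
    rw [← RingHom.map_det, h0, map_zero]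
  obtain ⟨v, hv, hvm⟩ := Matrix.exists_mulVec_eq_zero_iff.2 h0'
  set d : ℕ → ZMod 3 := fun i => if h : i < a + b then v ⟨i, h⟩ else 0 with hd
  have hdv : ∀ i : Fin (a + b), d i = v i := fun i => by simp [hd]
  have key : ∀ i < a + b, d i = 0 := by
    refine eq_zero_of_alternating_moments h2 a b d ?_ ?_
    · intro l hl
      have := congrFun hvm ⟨l, by omega⟩
      simp only [Matrix.mulVec, dotProduct, RingHom.mapMatrix_apply, Matrix.map_apply,
        momentMatrix, Matrix.of_apply, hl, if_true, map_mul, map_pow, eq_intCast, hk, hu, one_pow,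
        one_mul, Int.cast_natCast, Pi.zero_apply] at this
      rw [sum_range]
      refine (mul_eq_zero.1 (?_ : (2 : ZMod 3) ^ l * _ = 0)).resolve_left (pow_ne_zero _ h2)
      rw [mul_sum, ← this]
      exact sum_congr rfl fun i _ => by rw [hdv]; ring
    · intro l hl
      have := congrFun hvm ⟨l + b, by omega⟩
      simp only [Matrix.mulVec, dotProduct, RingHom.mapMatrix_apply, Matrix.map_apply,
        momentMatrix, Matrix.of_apply, map_mul, map_pow, eq_intCast, hk, hu, one_pow,
        not_lt.2 (Nat.le_add_left b l), if_false, Nat.add_sub_cancel, Int.cast_neg, Int.cast_one,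
        mul_one, Int.cast_natCast, Pi.zero_apply] at this
      rw [sum_range]
      refine (mul_eq_zero.1 (?_ : (2 : ZMod 3) ^ l * _ = 0)).resolve_left (pow_ne_zero _ h2)
      rw [mul_sum, ← this]
      exact sum_congr rfl fun i _ => by rw [hdv]; ring
  exact hv (funext fun i => by rw [← hdv, key i i.2, Pi.zero_apply])

/-- From the power moments to the Newton moments. -/
theorem sum_mul_prod_sub_eq_zero {K : Type*} [Field K] (n l : ℕ) (e x y : ℕ → K)
    (h : ∀ p ≤ l, ∑ i ∈ range n, e i * x i ^ p = 0) :
    ∑ i ∈ range n, e i * ∏ s ∈ range l, (x i - y s) = 0 := by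
  set Q : K[X] := ∏ s ∈ range l, (X - C (y s)) with hQ
  have hdeg : Q.natDegree < l + 1 := by
    rw [hQ, natDegree_prod_of_monic _ _ fun s _ => monic_X_sub_C _]
    simp
  have h1 : ∀ i, ∏ s ∈ range l, (x i - y s) = ∑ p ∈ range (l + 1), Q.coeff p * x i ^ p := by
    intro i
    rw [← eval_eq_sum_range' hdeg, hQ, eval_prod]
    simp
  simp only [h1, mul_sum]
  rw [sum_comm]
  refine sum_eq_zero fun p hp => ?_
  have := congrArg (Q.coeff p * ·) (h p (by have := mem_range.1 hp; omega))
  simp only [mul_zero, mul_sum] at this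
  rw [← this]
  exact sum_congr rfl fun i _ => by ring

/-- A sequence on a window of `a + b` consecutive integers `κ ≡ 1` modulo `3` is determined by its
first `b` moments and by the first `a` moments of its alternating version, where only exponents of
one fixed parity are used in each of the two families. -/
theorem eq_zero_of_kappa_moments {K : Type*} [Field K] [CharZero K] (a b : ℕ) (j₀ : ℤ)
    (s t : ℕ) (d : ℕ → K)
    (h1 : ∀ l < b, ∑ i ∈ range (a + b),
      d i * (kappa j₀ i : K) ^ s * ((kappa j₀ i : K) ^ 2) ^ l = 0)
    (h3 : ∀ l < a, ∑ i ∈ range (a + b),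
      d i * ((-1) ^ i * (kappa j₀ i : K) ^ t) * ((kappa j₀ i : K) ^ 2) ^ l = 0) :
    ∀ i < a + b, d i = 0 := by
  have hdet : ((Int.castRingHom K).mapMatrix (momentMatrix a b j₀ s t)).det ≠ 0 := by
    rw [← RingHom.map_det]
    simpa using det_momentMatrix_ne_zero a b j₀ s t
  have hprod : ∀ l i, ∏ s ∈ range l, (((kappa j₀ i : ℤ) : K) ^ 2 - ((kappa j₀ s : ℤ) : K) ^ 2)
      = 3 ^ l * l.factorial * (i.choose l * (kappaUnit j₀ l i : ℤ)) := fun l i => by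
    have := congrArg (Int.cast : ℤ → K) (prod_kappa_sq_sub j₀ l i)
    push_cast at this
    exact this
  have hne : ∀ l : ℕ, (3 : K) ^ l * l.factorial ≠ 0 := fun l =>
    mul_ne_zero (pow_ne_zero _ (by norm_num)) (Nat.cast_ne_zero.2 l.factorial_ne_zero)
  have hv := Matrix.eq_zero_of_mulVec_eq_zero hdet (v := fun i => d i) (by
    funext r
    simp only [Matrix.mulVec, dotProduct, RingHom.mapMatrix_apply, Matrix.map_apply,
      momentMatrix, Matrix.of_apply, Pi.zero_apply]
    by_cases hr : (r : ℕ) < b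
    · have := sum_mul_prod_sub_eq_zero (a + b) r _ (fun i => (kappa j₀ i : K) ^ 2)
        (fun i => (kappa j₀ i : K) ^ 2) (fun p hp => h1 p (by omega))
      refine (mul_eq_zero.1 (?_ : (3 : K) ^ (r : ℕ) * (r : ℕ).factorial * _ = 0)).resolve_left
        (hne r)
      rw [sum_range] at this
      rw [mul_sum, ← this]
      refine sum_congr rfl fun i _ => ?_
      rw [hprod]
      simp only [hr, if_true, map_mul, map_pow, eq_intCast, Int.cast_natCast]
      ring
    · have hra : (r : ℕ) - b < a := by have := r.2; omega
      have := sum_mul_prod_sub_eq_zero (a + b) (r - b) _ (fun i => (kappa j₀ i : K) ^ 2)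
        (fun i => (kappa j₀ i : K) ^ 2) (fun p hp => h3 p (by omega))
      refine (mul_eq_zero.1 (?_ : (3 : K) ^ (r - b : ℕ) * (r - b : ℕ).factorial * _ = 0)
        ).resolve_left (hne _)
      rw [sum_range] at this
      rw [mul_sum, ← this]
      refine sum_congr rfl fun i _ => ?_
      rw [hprod]
      simp only [hr, if_false, map_mul, map_pow, eq_intCast, Int.cast_natCast, Int.cast_neg,
        Int.cast_one]
      ring)
  intro i hi
  exact congrFun hv ⟨i, hi⟩

end Window

/-! ### Chebyshev polynomials and orders of vanishing at the end points -/

section Trigonometric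

open Polynomial Finset

variable {K : Type*} [Field K]

/-- The limits `x^i (x + 3)^⌊i/2⌋` of the basis polynomials at `ζ = -2`, up to constants. -/
noncomputable def trigP (K : Type*) [Field K] (i : ℕ) : K[X] := X ^ i * (X + 3) ^ (i / 2)

/-- The limits at `ζ = -2` of the images of the basis polynomials under `σ̂`, up to constants. -/
noncomputable def trigSigmaP (K : Type*) [Field K] (i : ℕ) : K[X] :=
  (if Even i then -(1 + X) else X + 3) * trigP K i

/-- The second order operator `(X² - 1) f'' + α X f' + β f`. For `(α, β) = (3, 1)` it has the
eigenvector `U_{k-1}`, and for `(α, β) = (1, 0)` the eigenvector `T_k`, with eigenvalue `k²`. -/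
noncomputable def chebOp (α β : K) : K[X] →ₗ[K] K[X] :=
  LinearMap.mulLeft K (X ^ 2 - 1) ∘ₗ derivative ∘ₗ derivative
    + LinearMap.mulLeft K (C α * X) ∘ₗ derivative + LinearMap.mulLeft K (C β)

theorem chebOp_apply (α β : K) (f : K[X]) : chebOp α β f =
    (X ^ 2 - 1) * derivative (derivative f) + C α * X * derivative f + C β * f := by
  simp [chebOp, mul_assoc]

theorem chebOp_U (k : ℤ) :
    chebOp 3 1 (Chebyshev.U K (k - 1)) = (k ^ 2 : K) • Chebyshev.U K (k - 1) := by
  have h := Chebyshev.one_sub_X_sq_mul_derivative_derivative_U_eq_poly_in_U (R := K) (k - 1)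
  rw [Function.iterate_succ, Function.iterate_one, Function.comp_apply] at h
  rw [chebOp_apply, smul_eq_C_mul]
  push_cast at h
  simp only [map_pow, map_intCast, map_one, map_ofNat]
  linear_combination -h

theorem chebOp_T (k : ℤ) :
    chebOp 1 0 (Chebyshev.T K k) = (k ^ 2 : K) • Chebyshev.T K k := by
  have h := Chebyshev.one_sub_X_sq_mul_derivative_derivative_T_eq_poly_in_T (R := K) k
  rw [Function.iterate_succ, Function.iterate_one, Function.comp_apply] at h
  rw [chebOp_apply, smul_eq_C_mul]
  simp only [map_pow, map_intCast, map_one, map_zero]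
  linear_combination -h

/-- At the singular points `±1` the operator lowers the order of vanishing by at most one. -/
theorem pow_dvd_chebOp (α β : K) {a : K} (ha : a * a = 1) {n : ℕ} {f : K[X]}
    (h : (X - C a) ^ (n + 1) ∣ f) : (X - C a) ^ n ∣ chebOp α β f := by
  have h1 : (X - C a) ^ n ∣ derivative f := by
    simpa using pow_sub_one_dvd_derivative_of_pow_dvd h
  have h2 : (X - C a) ^ n ∣ (X ^ 2 - 1) * derivative (derivative f) := by
    have e : (X ^ 2 - 1 : K[X]) = (X - C a) * (X + C a) := by
      have : (C a * C a : K[X]) = 1 := by rw [← C_mul, ha, C_1]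
      linear_combination this
    rcases n with _ | n
    · simp
    · have := pow_sub_one_dvd_derivative_of_pow_dvd h1
      rw [e, pow_succ', mul_assoc]
      exact mul_dvd_mul_left _ (this.trans (Dvd.intro_left _ rfl))
  rw [chebOp_apply]
  exact dvd_add (dvd_add h2 (h1.mul_left _)) (((pow_dvd_pow _ n.le_succ).trans h).mul_left _)

theorem eval_iterate_chebOp (α β : K) {a : K} (ha : a * a = 1) (l : ℕ) :
    ∀ {b : ℕ} {f : K[X]}, l < b → (X - C a) ^ b ∣ f → eval a ((chebOp α β ^ l) f) = 0 := by
  induction l with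
  | zero =>
    intro b f hb h
    obtain ⟨g, rfl⟩ := h
    simp [hb.ne']
  | succ l ih =>
    intro b f hb h
    obtain ⟨b, rfl⟩ : ∃ c, b = c + 1 := ⟨b - 1, by omega⟩
    rw [pow_succ, Module.End.mul_apply]
    exact ih (by omega) (pow_dvd_chebOp α β ha h)

/-- If a combination of eigenvectors of the operator vanishes to order `b` at one of the points
`±1`, then the first `b` moments of its coefficients vanish. -/
theorem moments_of_pow_dvd (α β : K) {a : K} (ha : a * a = 1) {b n : ℕ} (E : ℕ → K[X])
    (μ d : ℕ → K) (hE : ∀ i, chebOp α β (E i) = μ i • E i)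
    (h : (X - C a) ^ b ∣ ∑ i ∈ range n, d i • E i) (l : ℕ) (hl : l < b) :
    ∑ i ∈ range n, d i * eval a (E i) * μ i ^ l = 0 := by
  have hp : ∀ i, (chebOp α β ^ l) (E i) = μ i ^ l • E i := by
    intro i
    induction l with
    | zero => simp
    | succ l ih => rw [pow_succ, Module.End.mul_apply, hE, map_smul, ih (by omega), smul_smul,
        mul_comm, ← pow_succ]
  have := eval_iterate_chebOp α β ha l hl h
  rw [map_sum, eval_finsetSum] at this
  rw [← this]
  refine sum_congr rfl fun i _ => ?_
  rw [map_smul, hp, eval_smul, eval_smul, smul_eq_mul, smul_eq_mul]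
  ring

/-- The pair consisting of `U_{3j}` and its image under `σ̂`. -/
noncomputable def chebPair (K : Type*) [Field K] (j : ℤ) : K[X] × K[X] :=
  (Chebyshev.U K (3 * j), -2 * Chebyshev.T K (3 * j + 1))

/-- The span of `n` consecutive pairs, centred at `0`. -/
noncomputable def chebSpan (K : Type*) [Field K] (n : ℕ) : Submodule K (K[X] × K[X]) :=
  Submodule.span K ((fun i : ℕ => chebPair K (i + -(n / 2 : ℕ))) '' (range n : Set ℕ))

theorem chebPair_mem (n : ℕ) (j : ℤ) (h1 : -(n / 2 : ℕ) ≤ j) (h2 : j + (n / 2 : ℕ) < n) :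
    chebPair K j ∈ chebSpan K n := by
  refine Submodule.subset_span ⟨(j + (n / 2 : ℕ)).toNat, ?_, ?_⟩
  · simp only [coe_range, Set.mem_Iio]
    omega
  · simp only
    congr 1
    omega

theorem U_three_mul (m : ℤ) : 2 * Chebyshev.T K 3 * Chebyshev.U K m
    = Chebyshev.U K (m + 3) + Chebyshev.U K (m - 3) := by
  have h3 : Chebyshev.T K 3 = 2 * X * Chebyshev.T K 2 - Chebyshev.T K 1 :=
    Chebyshev.T_add_two K 1
  rw [h3, Chebyshev.T_two, Chebyshev.T_one]
  have e1 := Chebyshev.U_add_two K (m + 1)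
  have e2 := Chebyshev.U_add_two K m
  have e3 := Chebyshev.U_sub_two K m
  have e4 := Chebyshev.U_sub_two K (m - 1)
  have e5 := Chebyshev.U_add_one K m
  rw [show m + 1 + 2 = m + 3 by ring, show m + 1 + 1 = m + 2 by ring] at e1
  rw [show m - 1 - 2 = m - 3 by ring, show m - 1 - 1 = m - 2 by ring] at e4
  linear_combination -e1 - e4 - 2 * X * e2 - 2 * X * e3 - (4 * X ^ 2 - 1) * e5

theorem T_three_mul (m : ℤ) : 2 * Chebyshev.T K 3 * Chebyshev.T K m
    = Chebyshev.T K (m + 3) + Chebyshev.T K (m - 3) := by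
  rw [mul_assoc, ← mul_assoc, Chebyshev.T_mul_T, add_comm 3 m,
    show (3 : ℤ) - m = -(m - 3) by ring, Chebyshev.T_neg]

/-- Multiplication by the cubic `2 T₃ + 2` shifts `j` by one in both directions. -/
theorem smul_chebPair (j : ℤ) : (2 * Chebyshev.T K 3 + 2) • chebPair K j
    = chebPair K (j + 1) + chebPair K (j - 1) + (2 : K) • chebPair K j := by
  have e1 := U_three_mul (K := K) (3 * j)
  have e2 := T_three_mul (K := K) (3 * j + 1)
  simp only [chebPair, Prod.smul_mk, Prod.mk_add_mk, Prod.mk.injEq, smul_eq_mul, smul_eq_C_mul,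
    map_ofNat]
  constructor
  · rw [show 3 * (j + 1) = 3 * j + 3 by ring, show 3 * (j - 1) = 3 * j - 3 by ring]
    linear_combination e1
  · rw [show 3 * (j + 1) + 1 = 3 * j + 1 + 3 by ring,
      show 3 * (j - 1) + 1 = 3 * j + 1 - 3 by ring]
    linear_combination -2 * e2

theorem smul_mem_chebSpan {n : ℕ} {p : K[X] × K[X]} (hp : p ∈ chebSpan K n) :
    (2 * Chebyshev.T K 3 + 2) • p ∈ chebSpan K (n + 2) := by
  induction hp using Submodule.span_induction with
  | mem p hp =>
    obtain ⟨i, hi, rfl⟩ := hp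
    simp only [coe_range, Set.mem_Iio] at hi
    simp only [smul_chebPair]
    exact add_mem (add_mem (chebPair_mem _ _ (by omega) (by omega))
      (chebPair_mem _ _ (by omega) (by omega)))
      (Submodule.smul_mem _ _ (chebPair_mem _ _ (by omega) (by omega)))
  | zero => simp
  | add p q _ _ hp hq => rw [smul_add]; exact add_mem hp hq
  | smul c p _ hp => rw [smul_comm]; exact Submodule.smul_mem _ _ hp

/-- In terms of `cos θ`, where `x = 2 cos θ - 1`, the first `n` limit polynomials and their images
under `σ̂` are combinations, with the same coefficients, of the pairs
`(sin (κ θ) / sin θ, -2 cos (κ θ))` for `n` consecutive integers `κ ≡ 1` modulo `3`. -/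
theorem trigPair_mem (i : ℕ) :
    ((trigP K i).comp (2 * X - 1), (trigSigmaP K i).comp (2 * X - 1)) ∈ chebSpan K (i + 1) := by
  induction i using Nat.twoStepInduction with
  | zero =>
    convert chebPair_mem (K := K) 1 0 (by simp) (by simp) using 1
    simp only [trigP, trigSigmaP, chebPair]
    norm_num
    ring
  | one =>
    have h0 := chebPair_mem (K := K) 2 0 (by simp) (by simp)
    have h1 := chebPair_mem (K := K) 2 (-1) (by simp) (by simp)
    convert neg_mem (add_mem h0 h1) using 1
    have hU : Chebyshev.U K (3 * -1) = -(2 * X) := by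
      rw [show (3 * -1 : ℤ) = -1 - 2 by ring, Chebyshev.U_neg_sub_two, Chebyshev.U_one]
    have hT : Chebyshev.T K (3 * -1 + 1) = 2 * X ^ 2 - 1 := Chebyshev.T_neg_two K
    simp only [chebPair, hU, hT, trigP, trigSigmaP, Prod.mk_add_mk, Prod.neg_mk, Prod.mk.injEq]
    simp only [pow_one, mul_zero, zero_add, Chebyshev.U_zero, Chebyshev.T_one,
      Nat.not_even_one, if_false, mul_comp, X_comp, add_comp, ofNat_comp, pow_comp]
    norm_num
    constructor <;> ring
  | more i h0 _ =>
    have hz : (2 * Chebyshev.T K 3 + 2 : K[X]) = (X ^ 2 * (X + 3)).comp (2 * X - 1) := by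
      have h3 : Chebyshev.T K 3 = 2 * X * Chebyshev.T K 2 - Chebyshev.T K 1 :=
        Chebyshev.T_add_two K 1
      rw [h3, Chebyshev.T_two, Chebyshev.T_one]
      simp only [mul_comp, add_comp, pow_comp, X_comp, ofNat_comp]
      ring
    have e1 : trigP K (i + 2) = X ^ 2 * (X + 3) * trigP K i := by
      rw [trigP, trigP, show (i + 2) / 2 = i / 2 + 1 by omega]
      ring
    have e2 : trigSigmaP K (i + 2) = X ^ 2 * (X + 3) * trigSigmaP K i := by
      rw [trigSigmaP, trigSigmaP, e1]
      simp only [Nat.even_add, even_two, iff_true]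
      ring
    have := smul_mem_chebSpan h0
    rw [hz] at this
    rw [e1, e2, mul_comp, mul_comp _ (trigSigmaP K i)]
    exact this

/-- The polynomials `trigP i` have distinct degrees. -/
theorem trigP_linearIndependent (n : ℕ) (c : ℕ → K)
    (h : ∑ i ∈ range n, C (c i) * trigP K i = 0) : ∀ i < n, c i = 0 := by
  have hmon : ∀ i, (trigP K i).Monic := fun i =>
    (monic_X_pow i).mul ((monic_X_add_C (3 : K)).pow (i / 2))
  have hdeg : ∀ i, (trigP K i).natDegree = i + i / 2 := fun i => by
    rw [trigP, show (X + 3 : K[X]) = X + C 3 from rfl,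
      Monic.natDegree_mul (monic_X_pow i) ((monic_X_add_C _).pow _)]
    simp
  induction n with
  | zero => simp
  | succ n ih =>
    have hn : c n = 0 := by
      have := congrArg (fun p => p.coeff (n + n / 2)) h
      simp only [finsetSum_coeff, coeff_C_mul, coeff_zero] at this
      rw [sum_range_succ, sum_eq_zero, zero_add] at this
      · have h1 : (trigP K n).coeff (n + n / 2) = 1 := by
          rw [← hdeg]; exact hmon n
        rwa [h1, mul_one] at this
      · intro i hi
        have := mem_range.1 hi
        rw [coeff_eq_zero_of_natDegree_lt (by rw [hdeg]; omega), mul_zero]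
    rw [sum_range_succ, hn, C_0, zero_mul, add_zero] at h
    intro i hi
    rcases Nat.lt_succ_iff_lt_or_eq.1 hi with hi | rfl
    · exact ih h i hi
    · exact hn

variable [CharZero K]

/-- The eigenvalue equations turn vanishing of order `b` at `1` and of order `a` at `-1` into
vanishing moments; the values `U_{κ-1}(±1) = (±1)^(κ-1) κ` and `T_κ(±1) = (±1)^κ` decide which
parity of exponents occurs. -/
theorem eq_zero_of_chebPair_dvd (a b : ℕ) (j₀ : ℤ) (s t : Bool) (d : ℕ → K)
    (h1 : (X - C 1) ^ b ∣ ∑ i ∈ range (a + b), d i •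
      (if s then (chebPair K (i + j₀)).1 else (chebPair K (i + j₀)).2))
    (h3 : (X - C (-1)) ^ a ∣ ∑ i ∈ range (a + b), d i •
      (if t then (chebPair K (i + j₀)).1 else (chebPair K (i + j₀)).2)) :
    ∀ i < a + b, d i = 0 := by
  have hU : ∀ i : ℕ, chebOp 3 1 (chebPair K (i + j₀)).1
      = ((kappa j₀ i : K) ^ 2) • (chebPair K (i + j₀)).1 := fun i => by
    have := chebOp_U (K := K) (kappa j₀ i)
    rwa [show kappa j₀ i - 1 = 3 * (i + j₀) by simp [kappa]] at this
  have hT : ∀ i : ℕ, chebOp 1 0 (chebPair K (i + j₀)).2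
      = ((kappa j₀ i : K) ^ 2) • (chebPair K (i + j₀)).2 := fun i => by
    have h := chebOp_T (K := K) (kappa j₀ i)
    have e : (chebPair K (i + j₀)).2 = (-2 : K) • Chebyshev.T K (kappa j₀ i) := by
      rw [smul_eq_C_mul, C_neg]; rfl
    rw [e, map_smul, h, smul_comm]
  have hsign : ∀ (i : ℕ) (k : ℤ), ((Int.negOnePow (k + i) : ℤˣ) : K)
      = (Int.negOnePow k : ℤˣ) * (-1) ^ i := fun i k => by
    rw [Int.negOnePow_add]
    simp [Int.negOnePow_def]
  have hunit : ∀ k : ℤ, (((Int.negOnePow k : ℤˣ) : ℤ) : K) ≠ 0 := fun k =>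
    Int.cast_ne_zero.2 (Units.ne_zero _)
  refine eq_zero_of_kappa_moments a b j₀ (if s then 1 else 0) (if t then 1 else 0) d ?_ ?_
  · intro l hl
    cases s
    · have := moments_of_pow_dvd 1 0 (a := 1) (by ring) _ _ d hT (by simpa using h1) l hl
      refine (mul_eq_zero.1 (?_ : (-2 : K) * _ = 0)).resolve_left (by norm_num)
      rw [mul_sum, ← this]
      refine sum_congr rfl fun i _ => ?_
      simp [chebPair]
      ring
    · have := moments_of_pow_dvd 3 1 (a := 1) (by ring) _ _ d hU (by simpa using h1) l hl
      rw [← this]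
      refine sum_congr rfl fun i _ => ?_
      simp [chebPair, kappa]
  · intro l hl
    cases t
    · have := moments_of_pow_dvd 1 0 (a := -1) (by ring) _ _ d hT (by simpa using h3) l hl
      refine (mul_eq_zero.1 (?_ : (-2 * (Int.negOnePow (3 * j₀ + 1) : ℤˣ) : K) * _ = 0)
        ).resolve_left (mul_ne_zero (by norm_num) (hunit _))
      rw [mul_sum, ← this]
      refine sum_congr rfl fun i _ => ?_
      have e : Int.negOnePow (3 * (i + j₀) + 1) = Int.negOnePow (3 * j₀ + 1 + i) := by
        rw [show 3 * (i + j₀) + 1 = 3 * j₀ + 1 + i + 2 * i by ring, Int.negOnePow_add _ (2 * _),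
          Int.negOnePow_two_mul, mul_one]
      simp only [chebPair, eval_mul, eval_neg, eval_ofNat, Chebyshev.T_eval_neg_one, e]
      rw [hsign]
      simp
      ring
    · have := moments_of_pow_dvd 3 1 (a := -1) (by ring) _ _ d hU (by simpa using h3) l hl
      refine (mul_eq_zero.1 (?_ : ((Int.negOnePow (3 * j₀) : ℤˣ) : K) * _ = 0)
        ).resolve_left (hunit _)
      rw [mul_sum, ← this]
      refine sum_congr rfl fun i _ => ?_
      have e : Int.negOnePow (3 * (i + j₀)) = Int.negOnePow (3 * j₀ + i) := by
        rw [show 3 * (i + j₀) = 3 * j₀ + i + 2 * i by ring, Int.negOnePow_add _ (2 * _),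
          Int.negOnePow_two_mul, mul_one]
      simp only [chebPair, Chebyshev.U_eval_neg_one, e]
      rw [hsign]
      simp [kappa]
      ring

/-- No nonzero combination of the first `a + b` limit polynomials has the two properties that it or
its image under `σ̂` vanishes to order `b` at `1`, and that it or its image under `σ̂` vanishes to
order `a` at `-3`. -/
theorem eq_zero_of_trigP_dvd (a b : ℕ) (s t : Bool) (c : ℕ → K)
    (h1 : (X - C 1) ^ b ∣ ∑ i ∈ range (a + b), C (c i) *
      (if s then trigP K i else trigSigmaP K i))
    (h3 : (X + C 3) ^ a ∣ ∑ i ∈ range (a + b), C (c i) *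
      (if t then trigP K i else trigSigmaP K i)) :
    ∀ i < a + b, c i = 0 := by
  set n := a + b with hn
  set j₀ : ℤ := -(n / 2 : ℕ) with hj
  have hmem : ∑ i ∈ range n, c i •
      ((trigP K i).comp (2 * X - 1), (trigSigmaP K i).comp (2 * X - 1)) ∈ chebSpan K n := by
    refine sum_mem fun i hi => Submodule.smul_mem _ _ ?_
    have hin := mem_range.1 hi
    refine Submodule.span_le.2 ?_ (trigPair_mem i)
    rintro _ ⟨j, hj, rfl⟩
    simp only [coe_range, Set.mem_Iio] at hj
    exact chebPair_mem _ _ (by omega) (by omega)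
  obtain ⟨d, hd⟩ := (Submodule.mem_span_image_finset_iff_exists_fun' K).1 hmem
  have hd1 := congrArg Prod.fst hd
  have hd2 := congrArg Prod.snd hd
  simp only [Prod.fst_sum, Prod.snd_sum, Prod.smul_fst, Prod.smul_snd] at hd1 hd2
  have hcomp : ∀ (f : ℕ → K[X]), (∑ i ∈ range n, C (c i) * f i).comp (2 * X - 1)
      = ∑ i ∈ range n, c i • (f i).comp (2 * X - 1) := fun f => by
    rw [Polynomial.sum_comp]
    exact sum_congr rfl fun i _ => by rw [mul_comp, C_comp, smul_eq_C_mul]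
  have hd0 : ∀ i < n, d i = 0 := by
    have hcase : ∀ s : Bool, (∑ i ∈ range n, C (c i) *
        (if s then trigP K i else trigSigmaP K i)).comp (2 * X - 1) = ∑ i ∈ range n, d i •
        (if s then (chebPair K (i + j₀)).1 else (chebPair K (i + j₀)).2) := by
      intro s
      cases s
      · simp only [Bool.false_eq_true, if_false]
        rw [hcomp, hd2]
      · simp only [if_true]
        rw [hcomp, hd1]
    refine eq_zero_of_chebPair_dvd a b j₀ s t d ?_ ?_
    · have := map_dvd (compRingHom (2 * X - 1)) h1
      rw [map_pow, coe_compRingHom_apply, coe_compRingHom_apply, hcase] at this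
      refine (pow_dvd_pow_of_dvd ?_ b).trans this
      exact ⟨2, by simp only [sub_comp, X_comp, one_comp, map_one]; ring⟩
    · have := map_dvd (compRingHom (2 * X - 1)) h3
      rw [map_pow, coe_compRingHom_apply, coe_compRingHom_apply, hcase] at this
      refine (pow_dvd_pow_of_dvd ?_ a).trans this
      refine ⟨2, ?_⟩
      rw [add_comp, X_comp, C_comp, map_ofNat, map_neg, map_one]
      ring
  refine trigP_linearIndependent n c ?_
  have hz : (∑ i ∈ range n, C (c i) * trigP K i).comp (2 * X - 1) = 0 := by
    rw [hcomp, ← hd1]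
    exact sum_eq_zero fun i hi => by rw [hd0 i (mem_range.1 hi), zero_smul]
  have hinv : ((2 * X - 1 : K[X])).comp (C 2⁻¹ * (X + 1)) = X := by
    have h2 : (2 : K[X]) * C 2⁻¹ = 1 := by
      rw [show (2 : K[X]) = C 2 from rfl, ← C_mul]; simp
    simp only [sub_comp, mul_comp, ofNat_comp, X_comp, one_comp]
    linear_combination (X + 1) * h2
  have := congrArg (fun p => p.comp (C 2⁻¹ * (X + 1))) hz
  simpa [comp_assoc, hinv] using this

end Trigonometric

/-! ### Divided differences -/

section DividedDifferences

open Polynomial Finset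

variable {R : Type*} [CommRing R] {Λ : Type*} [DecidableEq Λ]

/-- The iterated quotient of `f` by the factors `X - x_s`, where `s < t` runs over the indices with
label `ℓ`. Its value at `x_t` is the divided difference of `f` at `x_t` and these points. -/
noncomputable def newtonQuot (lab : ℕ → Λ) (x : ℕ → R) (ℓ : Λ) (f : R[X]) : ℕ → R[X]
  | 0 => f
  | t + 1 => if lab t = ℓ then newtonQuot lab x ℓ f t /ₘ (X - C (x t))
      else newtonQuot lab x ℓ f t

/-- The Newton polynomial `∏ (X - x_s)` over the indices `s < t` with label `ℓ`. -/
noncomputable def newtonProd (lab : ℕ → Λ) (x : ℕ → R) (ℓ : Λ) (t : ℕ) : R[X] :=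
  ∏ s ∈ range t with lab s = ℓ, (X - C (x s))

theorem newtonProd_succ (lab : ℕ → Λ) (x : ℕ → R) (ℓ : Λ) (t : ℕ) :
    newtonProd lab x ℓ (t + 1) = if lab t = ℓ then newtonProd lab x ℓ t * (X - C (x t))
      else newtonProd lab x ℓ t := by
  simp only [newtonProd, prod_filter, prod_range_succ]
  split_ifs <;> simp

theorem divByMonic_X_sub_C_add (g : R[X]) (a : R) :
    C (g.eval a) + (X - C a) * (g /ₘ (X - C a)) = g := by
  have := modByMonic_add_div g (X - C a)
  rwa [modByMonic_X_sub_C_eq_C_eval] at this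

/-- Newton's interpolation formula with remainder. -/
theorem newton_expansion (lab : ℕ → Λ) (x : ℕ → R) (ℓ : Λ) (f : R[X]) (t : ℕ) :
    f = ∑ s ∈ range t with lab s = ℓ,
        C (eval (x s) (newtonQuot lab x ℓ f s)) * newtonProd lab x ℓ s
      + newtonQuot lab x ℓ f t * newtonProd lab x ℓ t := by
  induction t with
  | zero => simp [newtonQuot, newtonProd]
  | succ t ih =>
    conv_lhs => rw [ih]
    rw [newtonProd_succ, sum_filter, sum_filter, sum_range_succ]
    by_cases h : lab t = ℓ
    · simp only [newtonQuot, h, if_true]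
      have := divByMonic_X_sub_C_add (newtonQuot lab x ℓ f t) (x t)
      linear_combination -newtonProd lab x ℓ t * this
    · simp [newtonQuot, h]

theorem eval_newtonProd_eq_zero (lab : ℕ → Λ) (x : ℕ → R) {i t : ℕ} (h : i < t) :
    eval (x i) (newtonProd lab x (lab i) t) = 0 := by
  rw [newtonProd, eval_prod]
  exact prod_eq_zero (mem_filter.2 ⟨mem_range.2 h, rfl⟩) (by simp)

/-- The determinant of the values of polynomials, where rows with the same label carry the same
polynomials, is the product of the Vandermonde products of the labels and the determinant of the
divided differences. The latter makes sense at coinciding points. -/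
theorem det_eval_eq (n : ℕ) (lab : ℕ → Λ) (x : ℕ → R) (F : Λ → ℕ → R[X]) :
    (Matrix.of fun i c : Fin n => eval (x i) (F (lab i) c)).det =
      (∏ i : Fin n, ∏ s ∈ range (i : ℕ) with lab s = lab i, (x i - x s)) *
      (Matrix.of fun i c : Fin n =>
        eval (x i) (newtonQuot lab x (lab i) (F (lab i) c) i)).det := by
  set L : Matrix (Fin n) (Fin n) R := Matrix.of fun i s =>
    if lab s = lab i then eval (x i) (newtonProd lab x (lab i) s) else 0 with hL
  have hdet : L.det = ∏ i : Fin n, ∏ s ∈ range (i : ℕ) with lab s = lab i, (x i - x s) := by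
    rw [Matrix.det_of_isLowerTriangular]
    · refine prod_congr rfl fun i _ => ?_
      simp [hL, newtonProd, eval_prod]
    · intro i j hij
      simp only [OrderDual.toDual_lt_toDual] at hij
      simp only [hL, Matrix.of_apply]
      rw [eval_newtonProd_eq_zero lab x (by exact_mod_cast hij), ite_self]
  rw [← hdet, ← Matrix.det_mul]
  congr 1
  ext i c
  rw [Matrix.mul_apply, Matrix.of_apply]
  conv_lhs => rw [newton_expansion lab x (lab i) (F (lab i) c) n]
  rw [eval_add, eval_mul, eval_newtonProd_eq_zero lab x i.2, mul_zero, add_zero, eval_finsetSum,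
    sum_filter, sum_range]
  refine sum_congr rfl fun s _ => ?_
  simp only [hL, Matrix.of_apply]
  by_cases h : lab s = lab i
  · simp [h, mul_comm]
  · simp [h]

/-- A combination whose divided differences at the points with label `ℓ` vanish is divisible by
the product of all `X - x_s` with this label. -/
theorem newtonProd_dvd (n : ℕ) (lab : ℕ → Λ) (x : ℕ → R) (ℓ : Λ) (F : ℕ → R[X]) (v : ℕ → R)
    (h : ∀ i < n, lab i = ℓ →
      ∑ c ∈ range n, eval (x i) (newtonQuot lab x ℓ (F c) i) * v c = 0) :
    newtonProd lab x ℓ n ∣ ∑ c ∈ range n, C (v c) * F c := by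
  have h1 : ∑ c ∈ range n, C (v c) * F c
      = ∑ s ∈ range n with lab s = ℓ, C (∑ c ∈ range n,
          eval (x s) (newtonQuot lab x ℓ (F c) s) * v c) * newtonProd lab x ℓ s
        + (∑ c ∈ range n, C (v c) * newtonQuot lab x ℓ (F c) n) * newtonProd lab x ℓ n := by
    conv_lhs =>
      enter [2, c]
      rw [newton_expansion lab x ℓ (F c) n]
    simp only [map_sum, sum_mul, mul_add, sum_add_distrib, mul_sum]
    rw [sum_comm]
    congr 1
    · refine sum_congr rfl fun s _ => sum_congr rfl fun c _ => ?_
      rw [C_mul]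
      ring
    · exact sum_congr rfl fun c _ => by ring
  rw [h1, sum_eq_zero, zero_add]
  · exact Dvd.intro_left _ rfl
  · intro s hs
    obtain ⟨hs1, hs2⟩ := mem_filter.1 hs
    rw [h s (mem_range.1 hs1) hs2, C_0, zero_mul]

theorem newtonQuot_map {R' : Type*} [CommRing R'] (φ : R →+* R') (lab : ℕ → Λ) (x : ℕ → R) (ℓ : Λ)
    (f : R[X]) (t : ℕ) :
    (newtonQuot lab x ℓ f t).map φ = newtonQuot lab (fun i => φ (x i)) ℓ (f.map φ) t := by
  induction t with
  | zero => rfl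
  | succ t ih =>
    simp only [newtonQuot]
    split_ifs
    · rw [map_divByMonic φ (monic_X_sub_C _), ih]
      simp
    · exact ih

/-- Behaviour of divided differences under scaling of the points by `e`. -/
theorem newtonQuot_scale {K : Type*} [Field K] (lab : ℕ → Λ) (x y : ℕ → K) (ℓ : Λ) (e κ : K)
    (n : ℕ) (hy : ∀ i < n, lab i = ℓ → y i = e * x i) (f g : K[X])
    (hfg : g.comp (C e * X) = C κ * f) (t : ℕ) (ht : t ≤ n) :
    C (e ^ #{s ∈ range t | lab s = ℓ}) * (newtonQuot lab y ℓ g t).comp (C e * X)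
      = C κ * newtonQuot lab x ℓ f t := by
  induction t with
  | zero => simpa [newtonQuot] using hfg
  | succ t ih =>
    have ih := ih (by omega)
    rw [range_add_one, filter_insert]
    by_cases h : lab t = ℓ
    · rw [if_pos h, card_insert_of_notMem (by simp)]
      simp only [newtonQuot, if_pos h]
      rw [hy t (by omega) h]
      set p := newtonQuot lab y ℓ g t
      set q := newtonQuot lab x ℓ f t
      set w := #{s ∈ range t | lab s = ℓ}
      have h1 := divByMonic_X_sub_C_add p (e * x t)
      have h2 := divByMonic_X_sub_C_add q (x t)
      set p' := p /ₘ (X - C (e * x t))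
      have h3 := congrArg (fun r => r.comp (C e * X)) h1
      simp only [add_comp, mul_comp, sub_comp, C_comp, X_comp, C_mul] at h3
      have h4 := congrArg (eval (x t)) ih
      simp only [eval_mul, eval_C, eval_comp, eval_X] at h4
      have h5 := congrArg C h4
      rw [C_mul, C_mul] at h5
      refine mul_left_cancel₀ (X_sub_C_ne_zero (x t)) ?_
      rw [pow_succ, C_mul]
      linear_combination C (e ^ w) * h3 - C κ * h2 + ih - h5
    · rw [if_neg h]
      simp only [newtonQuot, if_neg h]
      exact ih

end DividedDifferences

/-! ### Points of two sizes -/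

section Scaling

open Polynomial Finset

variable {R : Type*} [CommRing R]

theorem newtonQuot_congr {Λ : Type*} [DecidableEq Λ] (lab : ℕ → Λ) (x y : ℕ → R) (ℓ : Λ)
    (f : R[X]) (t : ℕ) (h : ∀ i < t, lab i = ℓ → x i = y i) :
    newtonQuot lab x ℓ f t = newtonQuot lab y ℓ f t := by
  induction t with
  | zero => rfl
  | succ t ih =>
    have ih := ih fun i hi => h i (by omega)
    simp only [newtonQuot]
    split_ifs with ht
    · rw [ih, h t (by omega) ht]
    · exact ih

/-- The polynomials in the rows of the matrix, on two scales at once: with `(s, t) = (1, ζ + 2)`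
these are the `P_{c+1}` (if `plus` holds) and `σ̂ P_{c+1}` (otherwise); with `(s, t) = (ζ + 2, 1)`
they are the same polynomials as functions of `(ζ + 2) x`, up to a power of `ζ + 2`. -/
noncomputable def rowPoly (s t ζ : R) (N : ℕ) (plus : Bool) (c : ℕ) : R[X] :=
  (if plus then 1 else if Even c then (C t * X - C ζ) * (C s * C (2 * ζ + 1) - 3 * X)
    else (X - C s * C (2 * ζ + 1)) * (C t * X - 3 * C ζ)) *
  (X ^ c * (X - C s * C (2 * ζ + 1)) ^ (c / 2) * (C t * X - C ζ) ^ (N - (c + 2) / 2))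

theorem eval_rowPoly (ζ x : R) (N : ℕ) (plus : Bool) (c : ℕ) :
    eval x (rowPoly 1 (ζ + 2) ζ N plus c) = if plus then P N ζ c x else sigmaP N ζ c x := by
  rw [rowPoly, sigmaP, P, e₀, e₁]
  split_ifs <;> simp <;> ring

theorem map_rowPoly {R' : Type*} [CommRing R'] (φ : R →+* R') (s t ζ : R) (N : ℕ) (plus : Bool)
    (c : ℕ) : (rowPoly s t ζ N plus c).map φ = rowPoly (φ s) (φ t) (φ ζ) N plus c := by
  rw [rowPoly, rowPoly]
  split_ifs <;> simp [map_ofNat φ]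

/-- The degree of `P_{c+1}` up to its last factor: the order of growth of `P_{c+1}` at points of
size `1 / (ζ + 2)`. -/
def growth (c : ℕ) : ℕ := c + c / 2

theorem growth_mono : Monotone growth := fun a b h => by
  simp only [growth]
  omega

theorem growth_strictMono : StrictMono growth := fun a b h => by
  simp only [growth]
  omega

theorem rowPoly_comp (e ζ : R) (N : ℕ) (plus : Bool) (c : ℕ) :
    (rowPoly e 1 ζ N plus c).comp (C e * X)
      = C (e ^ (growth c + if plus then 0 else 1)) * rowPoly 1 e ζ N plus c := by
  rw [rowPoly, rowPoly, growth]
  have h1 : (X - C e * C (2 * ζ + 1) : R[X]).comp (C e * X) = C e * (X - C 1 * C (2 * ζ + 1)) := by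
    simp
    ring
  have h2 : (C 1 * X - C ζ : R[X]).comp (C e * X) = C e * X - C ζ := by simp
  simp only [mul_comp, pow_comp, h1, h2, X_comp, mul_pow, pow_add]
  split_ifs
  · simp
    ring
  · simp
    ring
  · simp
    ring

/-- The label of an index records whether it is among the first `p` indices and whether it belongs
to a point of size `1 / (ζ + 2)`. -/
def label (p : ℕ) (lg : ℕ → Bool) (i : ℕ) : Bool × Bool := (decide (i < p), lg i)

/-- The product of the differences of those pairs in `pairs N p` which have different sizes. -/
def mixedVand (N p : ℕ) (lg : ℕ → Bool) (x : ℕ → R) : R :=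
  ∏ a ∈ pairs N p with lg a.1 ≠ lg a.2, (x a.2 - x a.1)

theorem Vand_eq_mul (N p : ℕ) (lg : ℕ → Bool) (x : ℕ → R) :
    Vand N p (fun i => x i) = (∏ i : Fin (2 * N),
      ∏ s ∈ range (i : ℕ) with label p lg s = label p lg i, (x i - x s)) * mixedVand N p lg x := by
  have h1 : ∀ i : Fin (2 * N), ∏ s ∈ range (i : ℕ) with label p lg s = label p lg i, (x i - x s)
      = ∏ s : Fin (2 * N), if s < i ∧ label p lg s = label p lg i then x i - x s else 1 := by
    intro i
    have : range (i : ℕ) = (range (2 * N)).filter (· < (i : ℕ)) := by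
      ext s
      simp only [mem_range, mem_filter]
      have := i.2
      omega
    rw [this, filter_filter, prod_filter, prod_range]
    rfl
  rw [mixedVand, Vand, ← prod_filter_mul_prod_filter_not (pairs N p)
    (fun a => lg a.1 = lg a.2)]
  congr 1
  simp only [h1]
  rw [pairs, filter_filter, prod_filter, Fintype.prod_prod_type_right]
  refine prod_congr rfl fun i _ => prod_congr rfl fun s _ => if_congr ?_ rfl rfl
  simp only [label, Prod.mk.injEq, decide_eq_decide, and_assoc]
  constructor
  · rintro ⟨h1, h2, h3⟩
    have : (s : ℕ) < i := h1
    exact ⟨h1, by omega, h3⟩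
  · rintro ⟨h1, h2, h3⟩
    have : (s : ℕ) < i := h1
    exact ⟨h1, by omega, h3⟩

/-- The polynomial `T`, multiplied by the differences of points of different sizes, is a
determinant of divided differences. This holds at all points, coinciding or not, since it holds for
independent variables, where the remaining differences can be cancelled. -/
theorem T_mul_mixedVand (N p : ℕ) (lg : ℕ → Bool) (ζ : R) (x : ℕ → R) :
    T N p ζ (fun i => x i) * mixedVand N p lg x =
      (Matrix.of fun i c : Fin (2 * N) => eval (x i) (newtonQuot (label p lg) x (label p lg i)
        (rowPoly 1 (ζ + 2) ζ N (i < p) c) i)).det := by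
  set xv : ℕ → PolyRing N := fun i => if h : i < 2 * N then MvPolynomial.X ⟨i, h⟩ else 0 with hxv
  have hX : (fun i : Fin (2 * N) => xv i) = MvPolynomial.X := by
    funext i
    simp [hxv]
  have huniv : mixedVand N p lg xv * Tpoly N p =
      (Matrix.of fun i c : Fin (2 * N) => eval (xv i) (newtonQuot (label p lg) xv (label p lg i)
        (rowPoly 1 (zetaVar N + 2) (zetaVar N) N (i < p) c) i)).det := by
    have h1 := Vand_mul_Tpoly N p
    have h2 : A N p (zetaVar N) MvPolynomial.X = Matrix.of fun i c : Fin (2 * N) =>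
        eval (xv i) (rowPoly 1 (zetaVar N + 2) (zetaVar N) N (label p lg i).1 c) := by
      ext1 i c
      rw [← hX]
      simp [A, eval_rowPoly, label]
    have h3 := det_eval_eq (2 * N) (label p lg) xv
      (fun ℓ c => rowPoly 1 (zetaVar N + 2) (zetaVar N) N ℓ.1 c)
    have hne := Vand_ne_zero N p
    rw [h2, h3, ← hX, Vand_eq_mul N p lg, mul_assoc] at h1
    rw [← hX, Vand_eq_mul N p lg] at hne
    exact mul_left_cancel₀ (left_ne_zero_of_mul hne) h1
  set φ : PolyRing N →+* R :=
    MvPolynomial.eval₂Hom (Polynomial.eval₂RingHom (Int.castRingHom R) ζ) (fun i => x i) with hφ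
  have hφx : ∀ i < 2 * N, φ (xv i) = x i := fun i hi => by
    simp [hφ, hxv, hi]
  have hφζ : φ (zetaVar N) = ζ := by simp [hφ, zetaVar]
  have h := congrArg φ huniv
  rw [map_mul, RingHom.map_det] at h
  have hT : φ (Tpoly N p) = T N p ζ (fun i => x i) := rfl
  have hm : φ (mixedVand N p lg xv) = mixedVand N p lg x := by
    rw [mixedVand, mixedVand, map_prod]
    exact prod_congr rfl fun a _ => by rw [map_sub, hφx _ a.1.2, hφx _ a.2.2]
  rw [mul_comm, ← hT, ← hm, h]
  congr 1
  ext i c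
  rw [RingHom.mapMatrix_apply, Matrix.map_apply, Matrix.of_apply, Matrix.of_apply,
    ← eval_map_apply, newtonQuot_map, map_rowPoly, map_add, hφζ, map_one, map_ofNat, hφx i i.2]
  rw [newtonQuot_congr _ _ x]
  exact fun s hs _ => hφx s (by have := i.2; omega)

/-- The matrix of divided differences on the two scales, where the points marked by `lg` are
multiplied by `ζ + 2`, and where powers of `ζ + 2` are moved between rows and columns so that at
`ζ = -2` a block triangular matrix remains: the first `S` columns belong to the small points. -/
noncomputable def scaledMatrix (N p S : ℕ) (lg : ℕ → Bool) (ζ : R) (y : ℕ → R) :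
    Matrix (Fin (2 * N)) (Fin (2 * N)) R :=
  Matrix.of fun i c =>
    (ζ + 2) ^ (if lg i then growth S - growth c else growth c - growth S) *
      eval (y i) (newtonQuot (label p lg) y (label p lg i)
        (rowPoly (if lg i then ζ + 2 else 1) (if lg i then 1 else ζ + 2) ζ N (i < p) c) i)

/-- The differences of points of different sizes, multiplied by `ζ + 2`. -/
def scaledVand (N p : ℕ) (lg : ℕ → Bool) (ζ : R) (y : ℕ → R) : R :=
  ∏ a ∈ pairs N p with lg a.1 ≠ lg a.2,
    (if lg a.2 then y a.2 - (ζ + 2) * y a.1 else (ζ + 2) * y a.2 - y a.1)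

theorem map_scaledMatrix {R' : Type*} [CommRing R'] (φ : R →+* R') (N p S : ℕ) (lg : ℕ → Bool)
    (ζ : R) (y : ℕ → R) : φ (scaledMatrix N p S lg ζ y).det
      = (scaledMatrix N p S lg (φ ζ) (fun i => φ (y i))).det := by
  rw [RingHom.map_det]
  congr 1
  ext i c
  simp only [RingHom.mapMatrix_apply, Matrix.map_apply, scaledMatrix, Matrix.of_apply, map_mul,
    map_pow, map_add, map_ofNat, ← eval_map_apply, newtonQuot_map, map_rowPoly, apply_ite φ,
    map_one]

theorem map_scaledVand {R' : Type*} [CommRing R'] (φ : R →+* R') (N p : ℕ) (lg : ℕ → Bool)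
    (ζ : R) (y : ℕ → R) : φ (scaledVand N p lg ζ y)
      = scaledVand N p lg (φ ζ) (fun i => φ (y i)) := by
  simp only [scaledVand, map_prod, apply_ite φ, map_sub, map_mul, map_add, map_ofNat]

variable {K : Type*} [Field K]

/-- The power of `ζ + 2` which is split off from a row when passing to the scaled matrix. -/
def rowExp (p S : ℕ) (lg : ℕ → Bool) (i : ℕ) : ℤ :=
  if lg i then #{s ∈ range i | label p lg s = label p lg i} - growth S - (if i < p then 0 else 1)
  else 0

/-- The power of `ζ + 2` which is split off from a column when passing to the scaled matrix. -/
def colExp (S c : ℕ) : ℤ := if S ≤ c then growth S - growth c else 0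

theorem T_mul_scaledVand (N p S : ℕ) (lg : ℕ → Bool) (ζ : K) (hζ : ζ + 2 ≠ 0) (y : ℕ → K) :
    T N p ζ (fun i => if lg i then y i / (ζ + 2) else y i) * scaledVand N p lg ζ y =
      (ζ + 2) ^ (∑ i : Fin (2 * N), rowExp p S lg i + ∑ c : Fin (2 * N), colExp S c
        + #{a ∈ pairs N p | lg a.1 ≠ lg a.2}) * (scaledMatrix N p S lg ζ y).det := by
  set x : ℕ → K := fun i => if lg i then y i / (ζ + 2) else y i with hx
  set e := ζ + 2 with he
  have hmix : scaledVand N p lg ζ y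
      = e ^ (#{a ∈ pairs N p | lg a.1 ≠ lg a.2}) * mixedVand N p lg x := by
    rw [scaledVand, mixedVand, card_eq_sum_ones, ← prod_pow_eq_pow_sum, ← prod_mul_distrib]
    refine prod_congr rfl fun a ha => ?_
    have := (mem_filter.1 ha).2
    rw [pow_one]
    rcases h1 : lg a.1 with _ | _ <;> rcases h2 : lg a.2 with _ | _ <;> simp [h1, h2] at this
    · simp only [hx, h1, h2, ← he, if_true, Bool.false_eq_true, if_false]
      field_simp
    · simp only [hx, h1, h2, ← he, if_true, Bool.false_eq_true, if_false]
      field_simp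
  have hT := T_mul_mixedVand N p lg ζ x
  rw [hmix, zpow_add₀ hζ, zpow_natCast, mul_left_comm, hT, mul_comm ((e : K) ^ (_ : ℤ)), mul_assoc]
  congr 1
  have hentry : (Matrix.of fun i c : Fin (2 * N) => eval (x i) (newtonQuot (label p lg) x
      (label p lg i) (rowPoly 1 (ζ + 2) ζ N (i < p) c) i))
      = Matrix.of fun i c : Fin (2 * N) => e ^ rowExp p S lg i *
        (Matrix.of fun i c : Fin (2 * N) =>
          e ^ colExp S c * scaledMatrix N p S lg ζ y i c) i c := by
    ext i c
    simp only [Matrix.of_apply, scaledMatrix, ← he]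
    rcases hi : lg i with _ | _
    · have hq : newtonQuot (label p lg) x (label p lg i) (rowPoly 1 e ζ N (i < p) c) i
          = newtonQuot (label p lg) y (label p lg i) (rowPoly 1 e ζ N (i < p) c) i := by
        refine newtonQuot_congr _ _ _ _ _ _ fun s _ hs => ?_
        have : lg s = false := by rw [← hi]; exact congrArg Prod.snd hs
        simp [hx, this]
      rw [hq]
      have hxy : x i = y i := by simp [hx, hi]
      simp only [rowExp, hi, Bool.false_eq_true, if_false, zpow_zero, one_mul, hxy]
      rw [← mul_assoc]
      have : e ^ colExp S c * e ^ (growth c - growth S) = 1 := by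
        rw [colExp]
        split_ifs with h
        · have := growth_mono h
          rw [← zpow_natCast, ← zpow_add₀ hζ, Nat.cast_sub this]
          simp
        · have := growth_mono (not_le.1 h).le
          simp [Nat.sub_eq_zero_of_le this]
      rw [this, one_mul]
    · have hxi : y i = e * x i := by
        simp only [hx, hi, if_true]
        field_simp
      have hq := newtonQuot_scale (label p lg) x y (label p lg i) e
        (e ^ (growth c + if (i : ℕ) < p then 0 else 1)) i (fun s _ hs => by
          have : lg s = true := by rw [← hi]; exact congrArg Prod.snd hs
          simp only [hx, this, if_true]
          field_simp) (rowPoly 1 e ζ N (i < p) c) (rowPoly e 1 ζ N (i < p) c)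
        (by rw [rowPoly_comp]; simp) i le_rfl
      have hev := congrArg (eval (x i)) hq
      simp only [eval_mul, eval_C, eval_comp, eval_X, ← hxi] at hev
      simp only [rowExp, hi, if_true]
      set w := #{s ∈ range (i : ℕ) | label p lg s = label p lg i}
      set v := eval (y i) (newtonQuot (label p lg) y (label p lg i)
        (rowPoly e 1 ζ N (i < p) c) i)
      have hne : e ^ (growth c + if (i : ℕ) < p then 0 else 1) ≠ 0 := pow_ne_zero _ hζ
      refine mul_left_cancel₀ hne ?_
      rw [← hev]
      simp only [← mul_assoc]
      congr 1
      simp only [← zpow_natCast, ← zpow_add₀ hζ]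
      congr 1
      rw [colExp]
      split_ifs with h0 h1 h1
      all_goals
        first
        | rw [Nat.sub_eq_zero_of_le (growth_mono (by assumption))]
          push_cast
          ring
        | rw [Nat.cast_sub (growth_mono (not_le.1 (by assumption)).le)]
          push_cast
          ring
  have hzp : ∀ f : Fin (2 * N) → ℤ, ∏ i, e ^ f i = e ^ ∑ i, f i := fun f => by
    induction (univ : Finset (Fin (2 * N))) using Finset.induction_on with
    | empty => simp
    | insert a s ha ih => rw [prod_insert ha, sum_insert ha, zpow_add₀ hζ, ih]
  rw [hentry, Matrix.det_mul_column, Matrix.det_mul_row, hzp, hzp, zpow_add₀ hζ, mul_assoc]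

end Scaling

/-! ### Counting powers of `ζ + 2` -/

section Exponents

open Finset

theorem card_pairs_mem {n : ℕ} (s : Finset (Fin n)) :
    #{a : Fin n × Fin n | a.1 < a.2 ∧ a.1 ∈ s ∧ a.2 ∈ s} = (#s).choose 2 := by
  induction s using Finset.induction_on_max with
  | empty => simp
  | insert i s hi ih =>
    have hni : i ∉ s := fun h => lt_irrefl _ (hi i h)
    have hsplit : ({a : Fin n × Fin n | a.1 < a.2 ∧ a.1 ∈ insert i s ∧ a.2 ∈ insert i s} : Finset _)
        = ({a : Fin n × Fin n | a.1 < a.2 ∧ a.1 ∈ s ∧ a.2 ∈ s} : Finset _) ∪ s ×ˢ {i} := by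
      ext ⟨u, v⟩
      simp only [mem_filter, mem_univ, true_and, mem_insert, mem_union, mem_product,
        mem_singleton]
      constructor
      · rintro ⟨h, rfl | hu, rfl | hv⟩
        · exact absurd h (lt_irrefl _)
        · exact absurd h (hi v hv).asymm
        · exact Or.inr ⟨hu, rfl⟩
        · exact Or.inl ⟨h, hu, hv⟩
      · rintro (⟨h, hu, hv⟩ | ⟨hu, rfl⟩)
        · exact ⟨h, Or.inr hu, Or.inr hv⟩
        · exact ⟨hi u hu, Or.inr hu, Or.inl rfl⟩
    rw [hsplit, card_union_of_disjoint, ih, card_product, card_singleton, card_insert_of_notMem hni,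
      Nat.choose_succ_succ' _ 1, Nat.choose_one_right]
    · ring
    · rw [disjoint_left]
      rintro ⟨u, v⟩ h1 h2
      simp only [mem_filter, mem_product, mem_singleton] at h1 h2
      exact hni (h2.2 ▸ h1.2.2.2)

/-- The pairs of points of different sizes in `pairs N p`, the pairs of large points and the pairs
of small points on the same side of `p` make up all pairs on the same side of `p`. -/
theorem card_mixed_add (N p : ℕ) (lg : ℕ → Bool) :
    #{a ∈ pairs N p | lg a.1 ≠ lg a.2}
      + ∑ i : Fin (2 * N), (if lg i then #{s ∈ range i | label p lg s = label p lg i} else 0)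
      + ((#{i : Fin (2 * N) | label p lg i = (true, false)}).choose 2
        + (#{i : Fin (2 * N) | label p lg i = (false, false)}).choose 2)
      = (#{i : Fin (2 * N) | (i : ℕ) < p}).choose 2
        + (#{i : Fin (2 * N) | ¬ (i : ℕ) < p}).choose 2 := by
  have h1 : ∀ i : Fin (2 * N), #{s ∈ range (i : ℕ) | label p lg s = label p lg i}
      = ∑ s : Fin (2 * N), if s < i ∧ label p lg s = label p lg i then 1 else 0 := by
    intro i
    have : range (i : ℕ) = (range (2 * N)).filter (· < (i : ℕ)) := by
      ext s
      simp only [mem_range, mem_filter]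
      have := i.2
      omega
    rw [this, filter_filter, card_filter, sum_range]
    rfl
  have h2 : ∑ i : Fin (2 * N), (if lg i then
      #{s ∈ range (i : ℕ) | label p lg s = label p lg i} else 0)
      = ∑ a : Fin (2 * N) × Fin (2 * N), if lg a.2 = true ∧ a.1 < a.2 ∧
        label p lg a.1 = label p lg a.2 then 1 else 0 := by
    rw [Fintype.sum_prod_type_right]
    refine sum_congr rfl fun i _ => ?_
    rw [h1]
    by_cases h : lg i = true
    · simp [h]
    · simp [h]
  rw [← card_pairs_mem, ← card_pairs_mem, ← card_pairs_mem, ← card_pairs_mem, h2, pairs,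
    filter_filter]
  simp only [card_filter, ← sum_add_distrib]
  refine sum_congr rfl fun a _ => ?_
  simp only [mem_filter, mem_univ, true_and, label, Prod.mk.injEq]
  by_cases h : a.1 < a.2
  · have h' : (a.1 : ℕ) < a.2 := h
    by_cases ha : (a.1 : ℕ) < p <;> by_cases hb : (a.2 : ℕ) < p <;>
      rcases ea : lg a.1 with _ | _ <;> rcases eb : lg a.2 with _ | _ <;>
      simp [h, ha, hb] <;> omega
  · simp [h]

theorem sum_growth_even (h : ℕ) :
    ((∑ c ∈ range (2 * h), growth c : ℕ) : ℤ) = 3 * h ^ 2 - 2 * h := by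
  induction h with
  | zero => simp
  | succ h ih =>
    rw [show 2 * (h + 1) = 2 * h + 1 + 1 by ring, sum_range_succ, sum_range_succ]
    push_cast [growth] at ih ⊢
    rw [ih, show (2 * (h : ℤ)) / 2 = h by omega, show (2 * (h : ℤ) + 1) / 2 = h by omega]
    ring

theorem sum_growth_odd (h : ℕ) : ((∑ c ∈ range (2 * h + 1), growth c : ℕ) : ℤ) = 3 * h ^ 2 + h := by
  rw [sum_range_succ]
  have := sum_growth_even h
  push_cast [growth] at this ⊢
  rw [this, show (2 * (h : ℤ)) / 2 = h by omega]
  ring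

/-- The total power of `ζ + 2` in `T_mul_scaledVand`, where `A`, `a` are the numbers of large and
of small points among the first `p` points, and `B`, `b` those among the remaining ones. -/
theorem total_exponent (N p A a B b : ℕ) (lg : ℕ → Bool)
    (hA : #{i : Fin (2 * N) | label p lg i = (true, true)} = A)
    (ha : #{i : Fin (2 * N) | label p lg i = (true, false)} = a)
    (hB : #{i : Fin (2 * N) | label p lg i = (false, true)} = B)
    (hb : #{i : Fin (2 * N) | label p lg i = (false, false)} = b) :
    ∑ i : Fin (2 * N), rowExp p (a + b) lg i + ∑ c : Fin (2 * N), colExp (a + b) c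
        + #{e ∈ pairs N p | lg e.1 ≠ lg e.2}
      = (A + a).choose 2 + (B + b).choose 2 - a.choose 2 - b.choose 2 - B
        - (∑ c ∈ range (2 * N), growth c : ℕ) + (∑ c ∈ range (a + b), growth c : ℕ) := by
  have hp : #{i : Fin (2 * N) | (i : ℕ) < p} = A + a := by
    rw [← hA, ← ha, ← card_union_of_disjoint]
    · congr 1
      ext i
      rcases h : lg i <;> simp [label, h]
    · rw [disjoint_left]
      intro i h1 h2
      simp only [mem_filter] at h1 h2
      have := h1.2.symm.trans h2.2
      simp at this
  have hq : #{i : Fin (2 * N) | ¬ (i : ℕ) < p} = B + b := by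
    rw [← hB, ← hb, ← card_union_of_disjoint]
    · congr 1
      ext i
      rcases h : lg i <;> simp [label, h]
    · rw [disjoint_left]
      intro i h1 h2
      simp only [mem_filter] at h1 h2
      have := h1.2.symm.trans h2.2
      simp at this
  have htot : A + a + (B + b) = 2 * N := by
    rw [← hp, ← hq]
    have := card_filter_add_card_filter_not (s := (univ : Finset (Fin (2 * N))))
      (fun i => (i : ℕ) < p)
    simpa using this
  have hcard := card_mixed_add N p lg
  rw [hp, hq, ha, hb] at hcard
  have hrow : ∑ i : Fin (2 * N), rowExp p (a + b) lg i
      = ∑ i : Fin (2 * N), (if lg i then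
          (#{s ∈ range (i : ℕ) | label p lg s = label p lg i} : ℤ) else 0)
        - (A + B) * growth (a + b) - B := by
    rw [← hA, ← hB]
    simp only [card_filter, Nat.cast_sum, ← sum_add_distrib, sum_mul, ← sum_sub_distrib]
    refine sum_congr rfl fun i _ => ?_
    rcases h : lg i with _ | _ <;> by_cases hi : (i : ℕ) < p <;> simp [rowExp, label, h, hi]
  have hcol : ∑ c : Fin (2 * N), colExp (a + b) c
      = (A + B) * growth (a + b) - ((∑ c ∈ range (2 * N), growth c : ℕ) : ℤ)
        + (∑ c ∈ range (a + b), growth c : ℕ) := by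
    rw [← sum_range (fun c => colExp (a + b) c), show 2 * N = a + b + (A + B) by omega]
    rw [← Nat.cast_add A B]
    generalize a + b = S
    generalize A + B = M
    have hS : ∑ c ∈ range S, colExp S c = 0 :=
      sum_eq_zero fun c hc => if_neg (not_le.2 (mem_range.1 hc))
    rw [sum_range_add, sum_range_add _ S M, hS]
    simp only [colExp, Nat.le_add_right, if_true, sum_sub_distrib, sum_const, card_range]
    push_cast
    ring
  rw [hrow, hcol]
  have hcard' := congrArg (Nat.cast : ℕ → ℤ) hcard
  push_cast at hcard' ⊢
  linear_combination hcard'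

end Exponents

/-! ### The two blocks of the limit matrix -/

section Limit

open Polynomial Finset

variable {K : Type*} [Field K]

theorem rowPoly_small (N : ℕ) (plus : Bool) (c : ℕ) :
    rowPoly (1 : K) 0 (-2) N plus c = C ((if plus then 1 else 6) * 2 ^ (N - (c + 2) / 2)) *
      (if plus then trigP K c else trigSigmaP K c) := by
  have h2 : (C (-2 : K) : K[X]) = -2 := by simp [map_ofNat C]
  have h3 : (C (2 * -2 + 1 : K) : K[X]) = -3 := by
    rw [show (2 * -2 + 1 : K) = -3 by ring]
    simp [map_ofNat C]
  rw [rowPoly, trigSigmaP, trigP, h2, h3]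
  split_ifs
  · simp [map_ofNat C]
    ring
  · simp only [C_mul, C_pow, C_0, C_1, map_ofNat]
    ring
  · simp only [C_mul, C_pow, C_0, C_1, map_ofNat]
    ring

/-- Points outside a finite set at which a given space of polynomials can be tested. -/
theorem exists_test_points [Infinite K] (bad : Finset K) (m : ℕ) :
    ∀ (V : Submodule K K[X]) [FiniteDimensional K V], Module.finrank K V ≤ m →
      ∃ x : Fin m → K, (∀ j, x j ∉ bad) ∧ ∀ f ∈ V, (∀ j, eval (x j) f = 0) → f = 0 := by
  classical
  induction m with
  | zero =>
    intro V _ hV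
    have : V = ⊥ := Submodule.finrank_eq_zero.1 (by omega)
    refine ⟨Fin.elim0, fun j => j.elim0, fun f hf _ => ?_⟩
    rwa [this, Submodule.mem_bot] at hf
  | succ m ih =>
    intro V _ hV
    by_cases hbot : V = ⊥
    · obtain ⟨a, ha⟩ := Infinite.exists_notMem_finset bad
      refine ⟨fun _ => a, fun _ => ha, fun f hf _ => ?_⟩
      rwa [hbot, Submodule.mem_bot] at hf
    obtain ⟨f, hfV, hf⟩ := Submodule.exists_mem_ne_zero_of_ne_bot hbot
    obtain ⟨a, ha⟩ := Infinite.exists_notMem_finset (bad ∪ f.roots.toFinset)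
    rw [mem_union, not_or] at ha
    set V' := V ⊓ LinearMap.ker (leval a) with hV'
    have hlt : V' < V := by
      refine lt_of_le_of_ne inf_le_left fun h => ha.2 ?_
      rw [← h] at hfV
      simp only [Multiset.mem_toFinset, mem_roots hf]
      exact hfV.2
    have hfin : FiniteDimensional K V' := Submodule.finiteDimensional_of_le hlt.le
    have := Submodule.finrank_lt_finrank_of_lt hlt
    obtain ⟨x, hx, hx0⟩ := ih V' (by omega)
    refine ⟨Fin.cons a x, fun j => ?_, fun g hg h => ?_⟩
    · refine Fin.cases ?_ (fun j => ?_) j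
      · exact ha.1
      · exact hx j
    · exact hx0 g ⟨hg, h 0⟩ fun j => h j.succ

/-- The combinations `f` of the first `m + (a + b)` limit polynomials for which `f` or `σ̂ f`
vanishes to order `b` at `1`, and `f` or `σ̂ f` vanishes to order `a` at `-3`, are determined by
their values at `m` suitable points. -/
theorem exists_small_points [CharZero K] (bad : Finset K) (m a b : ℕ) (s t : Bool) :
    ∃ x : Fin m → K, (∀ j, x j ∉ bad) ∧ ∀ c : ℕ → K,
      (X - C 1) ^ b ∣ ∑ i ∈ range (m + (a + b)), C (c i) *
        (if s then trigP K i else trigSigmaP K i) →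
      (X + C 3) ^ a ∣ ∑ i ∈ range (m + (a + b)), C (c i) *
        (if t then trigP K i else trigSigmaP K i) →
      (∀ j, eval (x j) (∑ i ∈ range (m + (a + b)), C (c i) * trigP K i) = 0) →
      ∀ i < m + (a + b), c i = 0 := by
  set n := m + (a + b) with hn
  set comb : (ℕ → K[X]) → (Fin n → K) →ₗ[K] K[X] := fun F =>
    Fintype.linearCombination K (fun i : Fin n => F i) with hcomb
  have hcomb' : ∀ F (c : ℕ → K), comb F (fun i => c i) = ∑ i ∈ range n, C (c i) * F i := by
    intro F c
    simp only [hcomb, Fintype.linearCombination_apply, sum_range, smul_eq_C_mul]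
  set W : Submodule K (Fin n → K) :=
    ((Ideal.span {(X - C (1 : K)) ^ b}).restrictScalars K).comap
        (comb fun i => if s then trigP K i else trigSigmaP K i) ⊓
      ((Ideal.span {(X + C (3 : K)) ^ a}).restrictScalars K).comap
        (comb fun i => if t then trigP K i else trigSigmaP K i) with hW
  have hmemW : ∀ c : ℕ → K, (fun i : Fin n => c i) ∈ W ↔
      (X - C 1) ^ b ∣ ∑ i ∈ range n, C (c i) * (if s then trigP K i else trigSigmaP K i) ∧
      (X + C 3) ^ a ∣ ∑ i ∈ range n, C (c i) * (if t then trigP K i else trigSigmaP K i) := by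
    intro c
    rw [hW, Submodule.mem_inf, Submodule.mem_comap, Submodule.mem_comap,
      hcomb' (fun i => if s then trigP K i else trigSigmaP K i) c,
      hcomb' (fun i => if t then trigP K i else trigSigmaP K i) c,
      Submodule.restrictScalars_mem, Submodule.restrictScalars_mem, Ideal.mem_span_singleton,
      Ideal.mem_span_singleton]
  -- the last `m` coefficients determine an element of `W`
  set last : W →ₗ[K] (Fin m → K) :=
    (LinearMap.funLeft K K fun j : Fin m => (⟨a + b + j, by omega⟩ : Fin n)) ∘ₗ W.subtype with hlast
  have hinj : Function.Injective last := by
    rw [injective_iff_map_eq_zero]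
    rintro ⟨v, hv⟩ hv0
    set c : ℕ → K := fun i => if h : i < n then v ⟨i, h⟩ else 0 with hc
    have hcv : (fun i : Fin n => c i) = v := by
      funext i
      simp [hc]
    have hc0 : ∀ i, a + b ≤ i → c i = 0 := by
      intro i hi
      by_cases h : i < n
      · have := congrFun hv0 ⟨i - (a + b), by omega⟩
        simp only [hlast, LinearMap.comp_apply, Submodule.subtype_apply, LinearMap.funLeft_apply,
          Pi.zero_apply, Nat.add_sub_cancel' hi] at this
        simp [hc, h, this]
      · simp [hc, h]
    have hsum : ∀ F : ℕ → K[X], ∑ i ∈ range n, C (c i) * F i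
        = ∑ i ∈ range (a + b), C (c i) * F i := by
      intro F
      rw [hn, add_comm m, sum_range_add, sum_eq_zero (s := range m), add_zero]
      intro i _
      rw [hc0 _ (by omega), C_0, zero_mul]
    have hv' := hv
    rw [← hcv, hmemW, hsum, hsum] at hv'
    have hz := eq_zero_of_trigP_dvd a b s t c hv'.1 hv'.2
    refine Subtype.ext ((hcv.symm.trans ?_ : v = 0))
    funext i
    rcases lt_or_ge (i : ℕ) (a + b) with h | h
    · exact hz i h
    · exact hc0 i h
  have hrank : Module.finrank K (W.map (comb (trigP K))) ≤ m := by
    have h1 := LinearMap.finrank_le_finrank_of_injective hinj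
    rw [Module.finrank_fin_fun] at h1
    exact (Submodule.finrank_map_le _ _).trans h1
  obtain ⟨x, hx, hx0⟩ := exists_test_points bad m (W.map (comb (trigP K))) hrank
  refine ⟨x, hx, fun c h1 h3 hev => ?_⟩
  have hmem : ∑ i ∈ range n, C (c i) * trigP K i ∈ W.map (comb (trigP K)) := by
    rw [← hcomb']
    exact Submodule.mem_map_of_mem ((hmemW c).2 ⟨h1, h3⟩)
  exact trigP_linearIndependent n c (hx0 _ hmem hev)

/-- The polynomial `x^D f (6 / x)`, for `f` of degree at most `D`. The substitution `x ↦ 6 / x`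
exchanges the limits of the large points `ξ₁`, `ξ₂`, multiplied by `ζ + 2`, with those of the small
points `ξ₀`, `ξ₃`. -/
noncomputable def invert (D : ℕ) (f : K[X]) : K[X] := reflect D (f.comp (C 6 * X))

theorem invert_add (D : ℕ) (f g : K[X]) : invert D (f + g) = invert D f + invert D g := by
  rw [invert, add_comp, reflect_add]
  rfl

theorem invert_C_mul (D : ℕ) (a : K) (f : K[X]) : invert D (C a * f) = C a * invert D f := by
  rw [invert, mul_comp, C_comp, reflect_C_mul]
  rfl

theorem invert_sum {ι : Type*} (D : ℕ) (s : Finset ι) (v : ι → K) (F : ι → K[X]) :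
    invert D (∑ i ∈ s, C (v i) * F i) = ∑ i ∈ s, C (v i) * invert D (F i) := by
  classical
  induction s using Finset.induction_on with
  | empty => simp [invert]
  | insert i s hi ih => rw [sum_insert hi, sum_insert hi, invert_add, invert_C_mul, ih]

theorem natDegree_comp_le_of_le {f : K[X]} {D : ℕ} (h : f.natDegree ≤ D) :
    (f.comp (C 6 * X)).natDegree ≤ D :=
  natDegree_comp_le.trans ((Nat.mul_le_mul h ((natDegree_C_mul_le _ _).trans natDegree_X_le)).trans
    (Nat.mul_one D).le)

theorem invert_mul {f g : K[X]} {D E : ℕ} (hf : f.natDegree ≤ D) (hg : g.natDegree ≤ E) :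
    invert (D + E) (f * g) = invert D f * invert E g := by
  rw [invert, mul_comp, reflect_mul _ _ (natDegree_comp_le_of_le hf) (natDegree_comp_le_of_le hg)]
  rfl

theorem invert_linear (u w : K) : invert 1 (C u * X + C w) = C w * X + C (6 * u) := by
  have h : (C u * X + C w : K[X]).comp (C 6 * X) = C (6 * u) * X ^ 1 + C w * X ^ 0 := by
    simp only [add_comp, mul_comp, C_comp, X_comp, C_mul]
    ring
  rw [invert, h, reflect_add, reflect_C_mul_X_pow, reflect_C_mul_X_pow, revAt_le le_rfl,
    revAt_le (Nat.zero_le _)]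
  simp
  ring

theorem invert_linear_mul_linear (u w u' w' : K) :
    invert 2 ((C u * X + C w) * (C u' * X + C w'))
      = (C w * X + C (6 * u)) * (C w' * X + C (6 * u')) := by
  rw [← invert_linear, ← invert_linear, ← invert_mul natDegree_linear_le natDegree_linear_le]

theorem invert_linear_pow (u w : K) (n : ℕ) :
    invert n ((C u * X + C w) ^ n) = (C w * X + C (6 * u)) ^ n := by
  induction n with
  | zero => simp [invert]
  | succ n ih =>
    rw [pow_succ, invert_mul _ natDegree_linear_le, ih, invert_linear, pow_succ]
    exact (natDegree_pow_le.trans (Nat.mul_le_mul_left _ natDegree_linear_le)).trans (by omega)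

theorem invert_X_pow {D n : ℕ} (h : n ≤ D) : invert D (X ^ n : K[X]) = C (6 ^ n) * X ^ (D - n) := by
  rw [invert, pow_comp, X_comp, mul_pow, ← C_pow, reflect_C_mul_X_pow, revAt_le h]

theorem pow_dvd_invert {w : K} {n D : ℕ} {f : K[X]} (hf : f.natDegree ≤ D)
    (h : (X + C w) ^ n ∣ f) : (C w * X + C 6) ^ n ∣ invert D f := by
  obtain ⟨g, rfl⟩ := h
  by_cases hg : g = 0
  · simp [hg, invert]
  have hmon : ((X + C w) ^ n).Monic := (monic_X_add_C w).pow n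
  have hdeg : ((X + C w) ^ n).natDegree = n := by simp
  rw [hmon.natDegree_mul' hg, hdeg] at hf
  obtain ⟨E, rfl⟩ := Nat.exists_eq_add_of_le (Nat.le_of_add_right_le hf)
  rw [invert_mul hdeg.le (by omega)]
  have := invert_linear_pow (1 : K) w n
  rw [C_1, one_mul, mul_one] at this
  rw [this]
  exact Dvd.intro _ rfl

theorem rowPoly_large (N : ℕ) (plus : Bool) (c : ℕ) :
    rowPoly (0 : K) 1 (-2) N plus c = (if plus then 1 else if Even c then
      (C 1 * X + C 2) * (C (-3) * X + C 0) else (C 1 * X + C 0) * (C 1 * X + C 6)) *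
      (X ^ growth c * (C 1 * X + C 2) ^ (N - (c + 2) / 2)) := by
  have h2 : (C (-2 : K) : K[X]) = -2 := by simp [map_ofNat C]
  have h3 : (C (-3 : K) : K[X]) = -3 := by simp [map_ofNat C]
  rw [rowPoly, growth, h2, h3, pow_add]
  split_ifs <;> simp only [C_1, C_0, map_ofNat] <;> ring

theorem natDegree_rowPoly_large {N c : ℕ} (plus : Bool) (hc : c < 2 * N) :
    (rowPoly (0 : K) 1 (-2) N plus c).natDegree ≤ 3 * N - 2 + if plus then 0 else 2 := by
  have hb : (X ^ growth c * (C 1 * X + C 2) ^ (N - (c + 2) / 2) : K[X]).natDegree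
      ≤ 3 * N - 2 := by
    refine natDegree_mul_le.trans ((Nat.add_le_add (natDegree_X_pow_le _) (natDegree_pow_le.trans
      (Nat.mul_le_mul_left _ natDegree_linear_le))).trans ?_)
    rw [growth]
    omega
  rw [rowPoly_large, add_comm (3 * N - 2)]
  refine natDegree_mul_le.trans (Nat.add_le_add ?_ hb)
  split_ifs
  · simp
  · exact natDegree_mul_le.trans (Nat.add_le_add natDegree_linear_le natDegree_linear_le)
  · exact natDegree_mul_le.trans (Nat.add_le_add natDegree_linear_le natDegree_linear_le)

/-- The substitution `x ↦ 6 / x` reverses the order of the limit polynomials. -/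
theorem invert_rowPoly_large {N r : ℕ} (plus : Bool) (hr : r < 2 * N) :
    invert (3 * N - 2 + if plus then 0 else 2)
        (rowPoly (0 : K) 1 (-2) N plus (2 * N - 1 - r))
      = C ((if plus then 1 else -36) * (6 ^ growth (2 * N - 1 - r) * 2 ^ (r / 2))) *
        (if plus then trigP K r else trigSigmaP K r) := by
  have hq : N - (2 * N - 1 - r + 2) / 2 = r / 2 := by omega
  have hb : invert (3 * N - 2) (X ^ growth (2 * N - 1 - r) * (C 1 * X + C 2) ^ (r / 2))
      = C (6 ^ growth (2 * N - 1 - r) * 2 ^ (r / 2)) * trigP K r := by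
    have hD : 3 * N - 2 = growth (2 * N - 1 - r) + r + r / 2 := by
      rw [growth]
      omega
    rw [hD, invert_mul ((natDegree_X_pow_le _).trans (Nat.le_add_right _ _))
      (natDegree_pow_le.trans ((Nat.mul_le_mul_left _ natDegree_linear_le).trans (by omega))),
      invert_linear_pow, invert_X_pow (Nat.le_add_right _ _), Nat.add_sub_cancel_left, trigP]
    have : (C 2 * X + C (6 * 1) : K[X]) = C 2 * (X + 3) := by
      simp only [mul_one, map_ofNat]
      ring
    rw [this, mul_pow, C_mul, C_pow (a := 2)]
    ring
  have hdeg : (X ^ growth (2 * N - 1 - r) * (C 1 * X + C 2) ^ (r / 2) : K[X]).natDegree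
      ≤ 3 * N - 2 := by
    have := natDegree_rowPoly_large (K := K) true (c := 2 * N - 1 - r) (N := N) (by omega)
    simpa only [rowPoly_large, if_true, one_mul, add_zero, hq] using this
  rw [rowPoly_large, hq, trigSigmaP]
  have h36 : (C (-36 : K) : K[X]) = -36 := by simp [map_ofNat C]
  have h3 : (C (-3 : K) : K[X]) = -3 := by simp [map_ofNat C]
  cases plus
  · simp only [Bool.false_eq_true, if_false]
    have hpar : Even (2 * N - 1 - r) ↔ ¬ Even r := by
      rw [Nat.even_iff, Nat.even_iff]
      omega
    rw [add_comm (3 * N - 2), invert_mul _ hdeg, hb, C_mul (a := -36), h36]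
    · by_cases h : Even r
      · rw [if_neg (by simpa [hpar] using h), if_pos h, invert_linear_mul_linear]
        simp only [C_0, map_ofNat, mul_one]
        ring
      · rw [if_pos (hpar.2 h), if_neg h, invert_linear_mul_linear, C_mul (b := -3), h3]
        simp only [C_0, map_ofNat, mul_one]
        ring
    · split_ifs
      · exact natDegree_mul_le.trans (Nat.add_le_add natDegree_linear_le natDegree_linear_le)
      · exact natDegree_mul_le.trans (Nat.add_le_add natDegree_linear_le natDegree_linear_le)
  · simp only [if_true, one_mul, add_zero]
    exact hb

/-- The analogue of `eq_zero_of_trigP_dvd` at the limits `-2` and `6` of the large points. -/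
theorem eq_zero_of_rowPoly_large_dvd [CharZero K] {N a b : ℕ} (hN : a + b ≤ 2 * N) (s t : Bool)
    (v : ℕ → K)
    (h1 : (X - C 6) ^ b ∣ ∑ r ∈ range (a + b), C (v r) * rowPoly 0 1 (-2) N s (2 * N - 1 - r))
    (h3 : (X + C 2) ^ a ∣ ∑ r ∈ range (a + b), C (v r) * rowPoly 0 1 (-2) N t (2 * N - 1 - r)) :
    ∀ r < a + b, v r = 0 := by
  have hdeg : ∀ u : Bool, (∑ r ∈ range (a + b), C (v r) *
      rowPoly (0 : K) 1 (-2) N u (2 * N - 1 - r)).natDegree ≤ 3 * N - 2 + if u then 0 else 2 := by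
    refine fun u => natDegree_sum_le_of_forall_le _ _ fun r hr => (natDegree_C_mul_le _ _).trans ?_
    have := mem_range.1 hr
    exact natDegree_rowPoly_large u (by omega)
  have hinv : ∀ u : Bool, invert (3 * N - 2 + if u then 0 else 2) (∑ r ∈ range (a + b), C (v r) *
      rowPoly (0 : K) 1 (-2) N u (2 * N - 1 - r)) = C (if u then 1 else -36) *
        ∑ r ∈ range (a + b), C (v r * (6 ^ growth (2 * N - 1 - r) * 2 ^ (r / 2))) *
          (if u then trigP K r else trigSigmaP K r) := by
    intro u
    rw [invert_sum, mul_sum]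
    refine sum_congr rfl fun r hr => ?_
    have := mem_range.1 hr
    rw [invert_rowPoly_large u (by omega), C_mul, C_mul (a := v r)]
    ring
  have hunit : ∀ u : Bool, IsUnit (C (if u then 1 else -36 : K)) := fun u =>
    isUnit_C.2 (IsUnit.mk0 _ (by split_ifs <;> norm_num))
  rw [sub_eq_add_neg, ← C_neg] at h1
  have e1 := pow_dvd_invert (hdeg s) h1
  have e3 := pow_dvd_invert (hdeg t) h3
  rw [hinv, (hunit _).dvd_mul_left] at e1 e3
  have hne : ∀ r, (6 ^ growth (2 * N - 1 - r) * 2 ^ (r / 2) : K) ≠ 0 := fun r =>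
    mul_ne_zero (pow_ne_zero _ (by norm_num)) (pow_ne_zero _ two_ne_zero)
  have key := eq_zero_of_trigP_dvd a b s t _
    ((pow_dvd_pow_of_dvd ⟨C (-6), ?_⟩ b).trans e1) ((pow_dvd_pow_of_dvd ⟨C 2, ?_⟩ a).trans e3)
  · exact fun r hr => (mul_eq_zero.1 (key r hr)).resolve_right (hne r)
  · simp only [C_neg, C_1, map_ofNat]
    ring
  · simp only [map_ofNat]
    ring

/-- At `ζ = -2` the scaled matrix is block triangular, so that its determinant does not vanish if
the two blocks have no kernel. The kernels are described by divisibility. -/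
theorem det_scaledMatrix_ne_zero (N p S : ℕ) (hS : S ≤ 2 * N) (lg : ℕ → Bool) (y : ℕ → K)
    (hlarge : ∀ v : ℕ → K, (∀ u, newtonProd (label p lg) y (u, true) (2 * N) ∣
      ∑ r ∈ range (2 * N - S), C (v r) * rowPoly 0 1 (-2) N u (2 * N - 1 - r)) →
      ∀ r < 2 * N - S, v r = 0)
    (hsmall : ∀ v : ℕ → K, (∀ u, newtonProd (label p lg) y (u, false) (2 * N) ∣
      ∑ c ∈ range S, C (v c) * rowPoly 1 0 (-2) N u c) → ∀ c < S, v c = 0) :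
    (scaledMatrix N p S lg (-2) y).det ≠ 0 := by
  intro h0
  obtain ⟨w, hw, hwm⟩ := Matrix.exists_mulVec_eq_zero_iff.2 h0
  set v : ℕ → K := fun i => if h : i < 2 * N then w ⟨i, h⟩ else 0 with hv
  have hvw : ∀ i : Fin (2 * N), w i = v i := fun i => by simp [hv]
  have hrow : ∀ i < 2 * N, ∑ c ∈ range (2 * N),
      (0 : K) ^ (if lg i then growth S - growth c else growth c - growth S) *
      eval (y i) (newtonQuot (label p lg) y (label p lg i)
        (rowPoly (if lg i then 0 else 1) (if lg i then 1 else 0) (-2) N (i < p) c) i) *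
        v c = 0 := by
    intro i hi
    have := congrFun hwm ⟨i, hi⟩
    simp only [Matrix.mulVec, dotProduct, scaledMatrix, Matrix.of_apply, Pi.zero_apply, hvw,
      neg_add_cancel] at this
    rw [sum_range]
    exact this
  have hvS : ∀ c, S ≤ c → c < 2 * N → v c = 0 := by
    have hdvd : ∀ u, newtonProd (label p lg) y (u, true) (2 * N) ∣
        ∑ r ∈ range (2 * N - S), C (v (2 * N - 1 - r)) * rowPoly 0 1 (-2) N u (2 * N - 1 - r) := by
      intro u
      have h1 := newtonProd_dvd (2 * N) (label p lg) y (u, true)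
        (fun c => rowPoly (0 : K) 1 (-2) N u c) (fun c => if S ≤ c then v c else 0) (by
          intro i hi hu
          have hlab := hu
          simp only [label, Prod.mk.injEq] at hu
          have := hrow i hi
          simp only [hu.2, if_true, hu.1, hlab] at this
          refine Eq.trans (sum_congr rfl fun c _ => ?_) this
          split_ifs with hc
          · rw [Nat.sub_eq_zero_of_le (growth_mono hc), pow_zero, one_mul]
          · have := growth_strictMono (not_le.1 hc)
            rw [zero_pow (by omega), mul_zero, zero_mul, zero_mul])
      convert h1 using 1
      rw [← sum_range_reflect _ (2 * N)]
      conv_rhs => rw [show 2 * N = 2 * N - S + S by omega]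
      rw [sum_range_add, sum_eq_zero (s := range S), add_zero]
      · refine sum_congr rfl fun r hr => ?_
        have := mem_range.1 hr
        rw [Nat.sub_add_cancel hS, if_pos (by omega)]
      · intro c hc
        have := mem_range.1 hc
        rw [if_neg (by omega), C_0, zero_mul]
    intro c hc hc'
    have := hlarge (fun r => v (2 * N - 1 - r)) hdvd (2 * N - 1 - c) (by omega)
    simpa [show 2 * N - 1 - (2 * N - 1 - c) = c by omega] using this
  have hvs : ∀ c < S, v c = 0 := by
    refine hsmall v fun u => ?_
    have h1 := newtonProd_dvd (2 * N) (label p lg) y (u, false)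
      (fun c => rowPoly (1 : K) 0 (-2) N u c) (fun c => if c < S then v c else 0) (by
        intro i hi hu
        have hlab := hu
        simp only [label, Prod.mk.injEq] at hu
        have := hrow i hi
        simp only [hu.2, Bool.false_eq_true, if_false, hu.1, hlab] at this
        refine Eq.trans (sum_congr rfl fun c hc => ?_) this
        split_ifs with hcS
        · rw [Nat.sub_eq_zero_of_le (growth_mono hcS.le), pow_zero, one_mul]
        · rw [hvS c (not_lt.1 hcS) (mem_range.1 hc), mul_zero, mul_zero])
    convert h1 using 1
    conv_rhs => rw [show 2 * N = S + (2 * N - S) by omega]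
    rw [sum_range_add, sum_eq_zero (s := range (2 * N - S)), add_zero]
    · exact sum_congr rfl fun c hc => by rw [if_pos (mem_range.1 hc)]
    · intro c _
      rw [if_neg (by omega), C_0, zero_mul]
  refine hw (funext fun i => ?_)
  rw [hvw, Pi.zero_apply]
  rcases lt_or_ge (i : ℕ) S with h | h
  · exact hvs i h
  · exact hvS i h i.2

end Limit

/-! ### The arguments of `T` -/

section Arguments

open Polynomial Finset

variable {R : Type*} [CommRing R]

/-- The points `ξ_j`, where the large ones `ξ₁` and `ξ₂` are marked by `true` and multiplied by
`ζ + 2`. -/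
def scaledXi (ζ : R) : Fin 4 → Bool × R :=
  ![(false, 2 * ζ + 1), (true, ζ), (true, ζ * (2 * ζ + 1)), (false, 1)]

/-- The list `xiList` with scaled and marked entries. -/
def scaledXiList (ζ : R) (a : Fin 4 → ℕ) : List (Bool × R) :=
  (List.finRange 4).flatMap fun j => List.replicate (a j) (scaledXi ζ j)

/-- The list `args` with scaled and marked entries. -/
def scaledArgs {m : ℕ} (k : Fin 4 → ℤ) (ζ : R) (x : Fin m → R) : List (Bool × R) :=
  (List.ofFn fun j => (false, x j)) ++ scaledXiList ζ (kpos k) ++ scaledXiList ζ (kneg k)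

/-- Whether the `i`-th argument of `T` is one of the large points. The marks in `scaledArgs` do not
depend on `ζ` and the `x_j`, so that they are read off from the values `0`. -/
def isLarge (m : ℕ) (k : Fin 4 → ℤ) (i : ℕ) : Bool :=
  ((scaledArgs k (0 : ℤ) (fun _ : Fin m => 0)).getD i (false, 0)).1

/-- The `i`-th argument of `T`, multiplied by `ζ + 2` if it is large. -/
def scaledArg {m : ℕ} (k : Fin 4 → ℤ) (ζ : R) (x : Fin m → R) (i : ℕ) : R :=
  ((scaledArgs k ζ x).getD i (false, 0)).2

theorem getD_apply {α β : Type*} (f : α → β) (l : List α) (i : ℕ) (d : α) :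
    f (l.getD i d) = (l.map f).getD i (f d) := by
  simp [List.getD_eq_getElem?_getD, List.getElem?_map, Option.getD_map]

theorem map_scaledArgs {m : ℕ} {α : Type*} (k : Fin 4 → ℤ) (ζ : R) (x : Fin m → R)
    (f : Bool × R → α) : (scaledArgs k ζ x).map f = (List.ofFn fun j => f (false, x j))
      ++ ((List.finRange 4).flatMap fun j => List.replicate (kpos k j) (f (scaledXi ζ j)))
      ++ ((List.finRange 4).flatMap fun j => List.replicate (kneg k j) (f (scaledXi ζ j))) := by
  simp [scaledArgs, scaledXiList, List.map_flatMap, List.map_replicate, List.map_ofFn,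
    Function.comp_def]

theorem fst_scaledArgs_getD {m : ℕ} (k : Fin 4 → ℤ) (ζ : R) (x : Fin m → R) (i : ℕ) :
    ((scaledArgs k ζ x).getD i (false, 0)).1 = isLarge m k i := by
  have h : ∀ j, (scaledXi ζ j).1 = (scaledXi (0 : ℤ) j).1 := by
    intro j
    fin_cases j <;> rfl
  rw [isLarge, getD_apply Prod.fst, getD_apply Prod.fst, map_scaledArgs, map_scaledArgs]
  simp only [h]

theorem scaledArgs_getD {m : ℕ} (k : Fin 4 → ℤ) (ζ : R) (x : Fin m → R) (i : ℕ) :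
    (scaledArgs k ζ x).getD i (false, 0) = (isLarge m k i, scaledArg k ζ x i) :=
  Prod.ext (fst_scaledArgs_getD k ζ x i) rfl

theorem map_scaledArg {R' : Type*} [CommRing R'] (φ : R →+* R') {m : ℕ} (k : Fin 4 → ℤ) (ζ : R)
    (x : Fin m → R) (i : ℕ) : φ (scaledArg k ζ x i) = scaledArg k (φ ζ) (fun j => φ (x j)) i := by
  have h : ∀ j, φ (scaledXi ζ j).2 = (scaledXi (φ ζ) j).2 := by
    intro j
    fin_cases j <;> simp [scaledXi, map_ofNat φ]
  rw [scaledArg, scaledArg, getD_apply (fun q : Bool × R => φ q.2), getD_apply Prod.snd,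
    map_scaledArgs, map_scaledArgs]
  simp only [h, map_zero]

theorem args_getD {K : Type*} [Field K] {m : ℕ} (k : Fin 4 → ℤ) (ζ : K)
    (x : Fin m → K) (i : ℕ) : (args k ζ x).getD i 0
      = if isLarge m k i then scaledArg k ζ x i / (ζ + 2) else scaledArg k ζ x i := by
  set f : Bool × K → K := fun q => if q.1 then q.2 / (ζ + 2) else q.2 with hf
  have h : ∀ j, f (scaledXi ζ j) = xi ζ j := by
    intro j
    fin_cases j <;> simp [scaledXi, xi, hf]
  have hargs : args k ζ x = (scaledArgs k ζ x).map f := by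
    rw [map_scaledArgs]
    simp only [h]
    simp [args, xiList, hf]
  have h0 : (0 : K) = f (false, 0) := by simp [hf]
  rw [hargs, h0, ← getD_apply, scaledArgs_getD]

theorem length_scaledXiList (ζ : R) (a : Fin 4 → ℕ) : (scaledXiList ζ a).length = ∑ j, a j := by
  simp [scaledXiList, List.finRange_succ, Fin.sum_univ_four, add_assoc]

theorem prod_range_getD {α M : Type*} [CommMonoid M] (l : List α) (d : α) (f : α → M) :
    ∏ i ∈ range l.length, f (l.getD i d) = (l.map f).prod := by
  induction l with
  | nil => simp
  | cons a l ih =>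
    rw [List.length_cons, prod_range_succ', List.map_cons, List.prod_cons, ← ih, mul_comm]
    rfl

/-- The product over the indices with a given label, by the multiplicities of the points. -/
theorem newtonProd_scaledArg {m : ℕ} (k : Fin 4 → ℤ) (ζ : R) (x : Fin m → R) (u b : Bool) :
    newtonProd (label (m + ∑ j, kpos k j) (isLarge m k)) (scaledArg k ζ x) (u, b)
        (m + ∑ j, kpos k j + ∑ j, kneg k j)
      = (if u && !b then ∏ j, (X - C (x j)) else 1) *
        ∏ j, if (scaledXi ζ j).1 = b then
          (X - C (scaledXi ζ j).2) ^ (if u then kpos k j else kneg k j) else 1 := by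
  set p := m + ∑ j, kpos k j with hp
  set f : Bool → Bool × R → R[X] := fun v q => if (v, q.1) = (u, b) then X - C q.2 else 1 with hf
  set L₁ := (List.ofFn fun j => (false, x j)) ++ scaledXiList ζ (kpos k) with hL₁
  have hl₁ : L₁.length = p := by simp [hL₁, length_scaledXiList, hp]
  have hl₂ : (scaledXiList ζ (kneg k)).length = ∑ j, kneg k j := length_scaledXiList _ _
  have hlist : ∀ (v : Bool) (a : Fin 4 → ℕ),
      ((scaledXiList ζ a).map (f v)).prod = ∏ j, f v (scaledXi ζ j) ^ a j := by
    intro v a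
    simp [scaledXiList, List.finRange_succ, Fin.prod_univ_four, mul_assoc]
  have hsplit : newtonProd (label p (isLarge m k)) (scaledArg k ζ x) (u, b)
      (p + ∑ j, kneg k j) = (L₁.map (f true)).prod
        * ((scaledXiList ζ (kneg k)).map (f false)).prod := by
    rw [newtonProd, prod_filter, prod_range_add, ← prod_range_getD L₁ (false, 0),
      ← prod_range_getD (scaledXiList ζ (kneg k)) (false, 0), hl₁, hl₂]
    have hq : ∀ i, (isLarge m k i, scaledArg k ζ x i)
        = (L₁ ++ scaledXiList ζ (kneg k)).getD i (false, 0) := fun i =>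
      (scaledArgs_getD k ζ x i).symm
    congr 1
    · refine prod_congr rfl fun i hi => ?_
      have hi := mem_range.1 hi
      rw [← List.getD_append L₁ (scaledXiList ζ (kneg k)) _ _ (by omega), ← hq]
      simp [hf, label, hi]
    · refine prod_congr rfl fun i hi => ?_
      have : (scaledXiList ζ (kneg k)).getD i (false, 0)
          = (L₁ ++ scaledXiList ζ (kneg k)).getD (p + i) (false, 0) := by
        rw [List.getD_append_right _ _ _ _ (by omega), hl₁, Nat.add_sub_cancel_left]
      rw [this, ← hq]
      simp [hf, label]
  rw [hsplit, hlist, hL₁, List.map_append, List.prod_append, hlist, List.map_ofFn, List.prod_ofFn]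
  cases u
  · simp [hf, ite_pow]
  · cases b <;> simp [hf, ite_pow]

theorem card_label {m N : ℕ} (k : Fin 4 → ℤ) (hN : 2 * N = m + ∑ j, kpos k j + ∑ j, kneg k j)
    (u b : Bool) :
    #{i : Fin (2 * N) | label (m + ∑ j, kpos k j) (isLarge m k) i = (u, b)}
      = (if u && !b then m else 0)
        + ∑ j, if (scaledXi (0 : ℚ) j).1 = b then (if u then kpos k j else kneg k j) else 0 := by
  -- compare degrees in `newtonProd_scaledArg`
  have h := congrArg natDegree (newtonProd_scaledArg k (0 : ℚ) (fun _ : Fin m => 0) u b)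
  have hm1 : ∀ j : Fin 4, (if (scaledXi (0 : ℚ) j).1 = b then
      (X - C (scaledXi (0 : ℚ) j).2) ^ (if u then kpos k j else kneg k j) else 1).Monic := by
    intro j
    split_ifs
    · exact (monic_X_sub_C _).pow _
    · exact (monic_X_sub_C _).pow _
    · exact monic_one
  have hm2 : (if u && !b then ∏ _j : Fin m, (X - C (0 : ℚ)) else 1).Monic := by
    split_ifs
    · exact monic_prod_of_monic _ _ fun _ _ => monic_X_sub_C _
    · exact monic_one
  rw [hm2.natDegree_mul (monic_prod_of_monic _ _ fun j _ => hm1 j),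
    natDegree_prod_of_monic _ _ fun j _ => hm1 j, newtonProd,
    natDegree_prod_of_monic _ _ fun _ _ => monic_X_sub_C _, ← hN] at h
  simp only [natDegree_X_sub_C, sum_const, smul_eq_mul, mul_one, card_filter, sum_range] at h
  rw [card_filter, h]
  congr 1
  · split_ifs <;> simp
  · refine sum_congr rfl fun j _ => ?_
    split_ifs <;> simp

end Arguments

/-! ### `T_n^{(k)}` as a quotient of polynomials -/

section Quotient

open Polynomial Finset

variable {R : Type*} [CommRing R]

/-- The polynomial `(ζ + 2)² G(x / (ζ + 2), y / (ζ + 2))`. -/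
def largeG (ζ x y : R) : R :=
  x * y * (x + y) - ζ * (x ^ 2 + y ^ 2) - 2 * (ζ ^ 2 + 3 * ζ + 1) * x * y
    + ζ * (2 * ζ + 1) * (ζ + 2) * (x + y)

/-- The values of `G` at scaled and marked points, multiplied by `(ζ + 2)²` if at least one of the
points is large. -/
def scaledG (ζ : R) (q r : Bool × R) : R :=
  if q.1 || r.1 then
    largeG ζ (if q.1 then q.2 else (ζ + 2) * q.2) (if r.1 then r.2 else (ζ + 2) * r.2)
  else G ζ q.2 r.2

/-- The order of the pole of `G` at two points of given sizes. -/
def poleG (b c : Bool) : ℕ := if b || c then 2 else 0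

theorem map_scaledG {R' : Type*} [CommRing R'] (φ : R →+* R') (ζ : R) (q r : Bool × R) :
    φ (scaledG ζ q r) = scaledG (φ ζ) (q.1, φ q.2) (r.1, φ r.2) := by
  simp only [scaledG, largeG, G]
  split_ifs <;> simp only [map_add, map_sub, map_mul, map_pow, map_ofNat, map_one]

theorem map_scaledXi {R' : Type*} [CommRing R'] (φ : R →+* R') (ζ : R) (j : Fin 4) :
    ((scaledXi ζ j).1, φ (scaledXi ζ j).2) = scaledXi (φ ζ) j := by
  fin_cases j <;> simp [scaledXi, map_ofNat φ]

theorem pow_mul_G {K : Type*} [Field K] {ζ : K} (hζ : ζ + 2 ≠ 0) (q r : Bool × K) :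
    (ζ + 2) ^ poleG q.1 r.1 * G ζ (if q.1 then q.2 / (ζ + 2) else q.2)
      (if r.1 then r.2 / (ζ + 2) else r.2) = scaledG ζ q r := by
  obtain ⟨b, x⟩ := q
  obtain ⟨c, y⟩ := r
  cases b <;> cases c <;> simp only [poleG, scaledG, largeG, G, Bool.or_true, Bool.or_false,
    Bool.false_eq_true, if_true, if_false, pow_zero, one_mul]
  all_goals
    field_simp

theorem xi_eq {K : Type*} [Field K] (ζ : K) (j : Fin 4) : xi ζ j =
    if (scaledXi ζ j).1 then (scaledXi ζ j).2 / (ζ + 2) else (scaledXi ζ j).2 := by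
  fin_cases j <;> simp [scaledXi, xi]

/-- The number of small points. -/
def smallCount (m : ℕ) (k : Fin 4 → ℤ) : ℕ := m + kpos k 0 + kpos k 3 + (kneg k 0 + kneg k 3)

/-- The order of the pole at `ζ = -2` of the values of `G` in the denominator of `Tn`. -/
def denExp (m : ℕ) (k : Fin 4 → ℤ) : ℕ :=
  ∑ i, ∑ j, poleG (scaledXi (0 : ℤ) i).1 (scaledXi (0 : ℤ) j).1 * (kneg k i * kpos k j)
    + ∑ _j : Fin m, ∑ i, poleG false (scaledXi (0 : ℤ) i).1 * kneg k i

/-- The numerator of `Tn`, up to a power of `ζ + 2`: a polynomial in `ζ` and the `x_j`, which is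
compatible with ring homomorphisms. -/
noncomputable def tnNum {m : ℕ} (n : ℤ) (k : Fin 4 → ℤ) (ζ : R) (x : Fin m → R) : R :=
  (-1) ^ ((∑ j, kneg k j).choose 2) *
    (scaledMatrix (n + ∑ j, kneg k j).toNat (m + ∑ j, kpos k j) (smallCount m k) (isLarge m k) ζ
      (scaledArg k ζ x)).det

/-- The denominator of `Tn`, up to a power of `ζ + 2`: a polynomial in `ζ` and the `x_j`, which is
compatible with ring homomorphisms. -/
def tnDen {m : ℕ} (n : ℤ) (k : Fin 4 → ℤ) (ζ : R) (x : Fin m → R) : R :=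
  2 ^ (∑ j, kneg k j)
    * (∏ i, ∏ j, scaledG ζ (scaledXi ζ i) (scaledXi ζ j) ^ (kneg k i * kpos k j))
    * (∏ j, ∏ i, scaledG ζ (false, x j) (scaledXi ζ i) ^ (kneg k i))
    * scaledVand (n + ∑ j, kneg k j).toNat (m + ∑ j, kpos k j) (isLarge m k) ζ (scaledArg k ζ x)

theorem map_tnNum {R' : Type*} [CommRing R'] (φ : R →+* R') {m : ℕ} (n : ℤ) (k : Fin 4 → ℤ) (ζ : R)
    (x : Fin m → R) : φ (tnNum n k ζ x) = tnNum n k (φ ζ) (fun j => φ (x j)) := by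
  simp only [tnNum, map_mul, map_pow, map_neg, map_one, map_scaledMatrix, map_scaledArg]

theorem map_tnDen {R' : Type*} [CommRing R'] (φ : R →+* R') {m : ℕ} (n : ℤ) (k : Fin 4 → ℤ) (ζ : R)
    (x : Fin m → R) : φ (tnDen n k ζ x) = tnDen n k (φ ζ) (fun j => φ (x j)) := by
  simp only [tnDen, map_mul, map_pow, map_ofNat, map_prod, map_scaledG, map_scaledXi,
    map_scaledVand, map_scaledArg]

theorem two_mul_choose_two (n : ℕ) : 2 * (n.choose 2 : ℤ) = n * (n - 1) := by
  induction n with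
  | zero => simp
  | succ n ih =>
    rw [Nat.choose_succ_succ' n 1, Nat.choose_one_right]
    push_cast
    linear_combination ih

/-- The powers of `ζ + 2` from the numerator and from the denominator of `Tn` add up to the
exponent of the theorem. -/
theorem exponent_eq {m N : ℕ} (n : ℤ) (k : Fin 4 → ℤ) (hm : (m : ℤ) = 2 * n - ∑ j, k j)
    (hNn : (N : ℤ) = n + ∑ j, kneg k j) :
    ∑ i : Fin (2 * N), rowExp (m + ∑ j, kpos k j) (smallCount m k) (isLarge m k) i
      + ∑ c : Fin (2 * N), colExp (smallCount m k) c
      + #{e ∈ pairs N (m + ∑ j, kpos k j) | isLarge m k e.1 ≠ isLarge m k e.2}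
      + denExp m k = -trigExp n k := by
  have hk : ∀ j, k j = kpos k j - kneg k j := fun j => by
    simp only [kpos, kneg]
    omega
  have hN : 2 * N = m + ∑ j, kpos k j + ∑ j, kneg k j := by
    zify
    simp only [Fin.sum_univ_four, hk] at hm hNn ⊢
    push_cast at hm hNn ⊢
    linarith
  have hxi : (scaledXi (0 : ℚ) 0).1 = false ∧ (scaledXi (0 : ℚ) 1).1 = true ∧
      (scaledXi (0 : ℚ) 2).1 = true ∧ (scaledXi (0 : ℚ) 3).1 = false := ⟨rfl, rfl, rfl, rfl⟩
  have hxi' : (scaledXi (0 : ℤ) 0).1 = false ∧ (scaledXi (0 : ℤ) 1).1 = true ∧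
      (scaledXi (0 : ℤ) 2).1 = true ∧ (scaledXi (0 : ℤ) 3).1 = false := ⟨rfl, rfl, rfl, rfl⟩
  have hA := card_label k hN true true
  have ha := card_label k hN true false
  have hB := card_label k hN false true
  have hb := card_label k hN false false
  have htot := total_exponent N _ _ _ _ _ _ hA ha hB hb
  simp only [Fin.sum_univ_four, hxi, Bool.and_true, Bool.and_false, Bool.not_true, Bool.not_false,
    Bool.false_eq_true, Bool.true_eq_false, if_true, if_false, zero_add, add_zero, add_assoc]
    at htot
  have hS : smallCount m k = m + (kpos k 0 + (kpos k 3 + (kneg k 0 + kneg k 3))) := by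
    rw [smallCount]
    ring
  have hden : denExp m k = 2 * ((kneg k 1 + kneg k 2) * (m + (kpos k 0 + kpos k 3))
      + (kpos k 1 + kpos k 2) * (kneg k 0 + kneg k 3)
      + (kneg k 1 + kneg k 2) * (kpos k 1 + kpos k 2)) := by
    simp only [denExp, poleG, Fin.sum_univ_four, hxi', sum_const, card_univ, Fintype.card_fin,
      smul_eq_mul, Bool.or_true, Bool.or_false, Bool.false_eq_true, if_true, if_false]
    ring
  simp only [Fin.sum_univ_four, add_assoc] at hN ⊢
  rw [hS, hden]
  simp only [← add_assoc] at htot ⊢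
  rw [htot, trigExp, hk 1, hk 2]
  simp only [Fin.sum_univ_four] at hNn
  have hn : n = N - (kneg k 0 + kneg k 1 + kneg k 2 + kneg k 3) := by
    push_cast at hNn
    linarith
  rw [hn, sum_growth_even]
  have e1 := two_mul_choose_two (kpos k 1 + kpos k 2 + m + kpos k 0 + kpos k 3)
  have e2 := two_mul_choose_two (kneg k 1 + kneg k 2 + kneg k 0 + kneg k 3)
  have e3 := two_mul_choose_two (m + kpos k 0 + kpos k 3)
  have e4 := two_mul_choose_two (kneg k 0 + kneg k 3)
  generalize ((kpos k 1 + kpos k 2 + m + kpos k 0 + kpos k 3).choose 2 : ℤ) = c1 at *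
  generalize ((kneg k 1 + kneg k 2 + kneg k 0 + kneg k 3).choose 2 : ℤ) = c2 at *
  generalize ((m + kpos k 0 + kpos k 3).choose 2 : ℤ) = c3 at *
  generalize ((kneg k 0 + kneg k 3).choose 2 : ℤ) = c4 at *
  push_cast at e1 e2 e3 e4
  have hm' : (m : ℤ) = 2 * N - (kpos k 0 + kpos k 1 + kpos k 2 + kpos k 3)
      - (kneg k 0 + kneg k 1 + kneg k 2 + kneg k 3) := by
    zify at hN
    linarith
  -- the parity of the number of small points is that of `k₁ + k₂`, which decides the floor
  obtain ⟨h, hh | hh⟩ := Nat.even_or_odd' (m + kpos k 0 + kpos k 3 + kneg k 0 + kneg k 3)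
  · have hh' : (m : ℤ) + kpos k 0 + kpos k 3 + kneg k 0 + kneg k 3 = 2 * h := by exact_mod_cast hh
    rw [hh, sum_growth_even]
    have hdiff : (kpos k 1 - kneg k 1 + (kpos k 2 - kneg k 2) : ℤ)
        = 2 * (N - h - (kneg k 1 + kneg k 2)) := by linarith
    rw [hdiff]
    set g : ℤ := N - h - (kneg k 1 + kneg k 2) with hg
    have hdiv : (2 * g - 1) ^ 2 / 4 = g ^ 2 - g := by
      rw [show (2 * g - 1) ^ 2 = 1 + (g ^ 2 - g) * 4 by ring,
        Int.add_mul_ediv_right _ _ (by norm_num)]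
      norm_num
    rw [hdiv]
    have hp1 : (kpos k 1 : ℤ) = 2 * g + kneg k 1 + kneg k 2 - kpos k 2 := by linarith
    have hm2 : (m : ℤ) = 2 * h - kpos k 0 - kpos k 3 - kneg k 0 - kneg k 3 := by linarith
    have hN2 : (N : ℤ) = g + h + (kneg k 1 + kneg k 2) := by linarith
    clear_value g
    push_cast
    rw [hp1, hm2] at e1
    rw [hm2] at e3
    rw [hp1, hm2, hN2]
    refine mul_left_cancel₀ (two_ne_zero (α := ℤ)) ?_
    linear_combination e1 + e2 - e3 - e4
  · have hh' : (m : ℤ) + kpos k 0 + kpos k 3 + kneg k 0 + kneg k 3 = 2 * h + 1 := by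
      exact_mod_cast hh
    rw [hh, sum_growth_odd]
    have hdiff : (kpos k 1 - kneg k 1 + (kpos k 2 - kneg k 2) : ℤ)
        = 2 * (N - h - (kneg k 1 + kneg k 2)) - 1 := by linarith
    rw [hdiff]
    set g : ℤ := N - h - (kneg k 1 + kneg k 2) with hg
    have hdiv : (2 * g - 1 - 1) ^ 2 / 4 = (g - 1) ^ 2 := by
      rw [show (2 * g - 1 - 1) ^ 2 = (g - 1) ^ 2 * 4 by ring, Int.mul_ediv_cancel _ (by norm_num)]
    rw [hdiv]
    have hp1 : (kpos k 1 : ℤ) = 2 * g - 1 + kneg k 1 + kneg k 2 - kpos k 2 := by linarith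
    have hm2 : (m : ℤ) = 2 * h + 1 - kpos k 0 - kpos k 3 - kneg k 0 - kneg k 3 := by linarith
    have hN2 : (N : ℤ) = g + h + (kneg k 1 + kneg k 2) := by linarith
    clear_value g
    push_cast
    rw [hp1, hm2] at e1
    rw [hm2] at e3
    rw [hp1, hm2, hN2]
    refine mul_left_cancel₀ (two_ne_zero (α := ℤ)) ?_
    linear_combination e1 + e2 - e3 - e4

theorem toNat_add_sum_kneg {m : ℕ} (n : ℤ) (k : Fin 4 → ℤ) (hm : (m : ℤ) = 2 * n - ∑ j, k j) :
    (((n + (∑ j, kneg k j : ℕ)).toNat : ℕ) : ℤ) = n + (∑ j, kneg k j : ℕ) := by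
  refine Int.toNat_of_nonneg ?_
  simp only [Fin.sum_univ_four, kneg] at hm ⊢
  omega

/-- Away from `ζ = -2`, and where the denominators do not vanish, `Tn` is a quotient of polynomials
times the power of `ζ + 2` from the theorem. -/
theorem Tn_eq {K : Type*} [Field K] {m : ℕ} (n : ℤ) (k : Fin 4 → ℤ)
    (hm : (m : ℤ) = 2 * n - ∑ j, k j) (ζ : K) (hζ : ζ + 2 ≠ 0) (x : Fin m → K)
    (hden : tnDen n k ζ x ≠ 0) :
    Tn n k ζ x = (ζ + 2) ^ (-trigExp n k) * (tnNum n k ζ x / tnDen n k ζ x) := by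
  set N := (n + (∑ j, kneg k j : ℕ)).toNat with hN
  have hexp := exponent_eq (N := N) n k hm (by
    rw [hN, toNat_add_sum_kneg n k hm, Nat.cast_sum])
  have hT := T_mul_scaledVand N (m + ∑ j, kpos k j) (smallCount m k) (isLarge m k) ζ hζ
    (scaledArg k ζ x)
  have hfst : ∀ i, (scaledXi ζ i).1 = (scaledXi (0 : ℤ) i).1 := fun i => by fin_cases i <;> rfl
  have hG1 : ∏ i, ∏ j, scaledG ζ (scaledXi ζ i) (scaledXi ζ j) ^ (kneg k i * kpos k j)
      = (ζ + 2) ^ (∑ i, ∑ j, poleG (scaledXi (0 : ℤ) i).1 (scaledXi (0 : ℤ) j).1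
        * (kneg k i * kpos k j)) * ∏ i, ∏ j, G ζ (xi ζ i) (xi ζ j) ^ (kneg k i * kpos k j) := by
    simp only [← prod_pow_eq_pow_sum, ← prod_mul_distrib, ← pow_mul_G hζ, xi_eq, mul_pow, hfst,
      pow_mul]
  have hG2 : ∏ j, ∏ i, scaledG ζ (false, x j) (scaledXi ζ i) ^ (kneg k i)
      = (ζ + 2) ^ (∑ _j : Fin m, ∑ i, poleG false (scaledXi (0 : ℤ) i).1 * kneg k i)
        * ∏ j, ∏ i, G ζ (x j) (xi ζ i) ^ (kneg k i) := by
    simp only [← prod_pow_eq_pow_sum, ← prod_mul_distrib, ← pow_mul_G hζ, xi_eq, mul_pow, hfst,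
      pow_mul, Bool.false_eq_true, if_false]
  rw [Tn, tnNum]
  rw [tnDen] at hden ⊢
  rw [← hN] at hden ⊢
  simp only [args_getD]
  rw [hG1, hG2] at hden ⊢
  set Q1 := ∏ i, ∏ j, G ζ (xi ζ i) (xi ζ j) ^ (kneg k i * kpos k j)
  set Q2 := ∏ j, ∏ i, G ζ (x j) (xi ζ i) ^ (kneg k i)
  set V := scaledVand N (m + ∑ j, kpos k j) (isLarge m k) ζ (scaledArg k ζ x)
  have hV : V ≠ 0 := right_ne_zero_of_mul hden
  have hQ2 : Q2 ≠ 0 := right_ne_zero_of_mul (right_ne_zero_of_mul (left_ne_zero_of_mul hden))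
  have hQ1 : Q1 ≠ 0 := right_ne_zero_of_mul (right_ne_zero_of_mul
    (left_ne_zero_of_mul (left_ne_zero_of_mul hden)))
  have h2 : (2 : K) ^ (∑ j, kneg k j) ≠ 0 :=
    left_ne_zero_of_mul (left_ne_zero_of_mul (left_ne_zero_of_mul hden))
  rw [← hexp, zpow_add₀ hζ, zpow_natCast, denExp, pow_add]
  rw [← eq_div_iff hV] at hT
  rw [hT]
  have hE1 : (ζ + 2) ^ (∑ i, ∑ j, poleG (scaledXi (0 : ℤ) i).1 (scaledXi (0 : ℤ) j).1
    * (kneg k i * kpos k j)) ≠ 0 := pow_ne_zero _ hζ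
  have hE2 : (ζ + 2) ^ (∑ _j : Fin m, ∑ i, poleG false (scaledXi (0 : ℤ) i).1 * kneg k i) ≠ 0 :=
    pow_ne_zero _ hζ
  field_simp

end Quotient

/-! ### The values at `ζ = -2` -/

section AtMinusTwo

open Polynomial Finset

theorem scaledXi_neg_two {K : Type*} [Field K] : scaledXi (-2 : K) =
    ![(false, -3), (true, -2), (true, 6), (false, 1)] := by
  rw [scaledXi]
  norm_num

theorem scaledArg_ne_zero {m : ℕ} (k : Fin 4 → ℤ) (x : Fin m → ℂ) (i : ℕ)
    (hi : isLarge m k i = true) : scaledArg k (-2 : ℂ) x i ≠ 0 := by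
  have h := scaledArgs_getD k (-2 : ℂ) x i
  have hmem : ∀ q ∈ scaledArgs k (-2 : ℂ) x, q.1 = true → q.2 ≠ 0 := by
    have hxi : ∀ j, (scaledXi (-2 : ℂ) j).1 = true → (scaledXi (-2 : ℂ) j).2 ≠ 0 := by
      rw [scaledXi_neg_two]
      intro j
      fin_cases j <;> simp
    intro q hq
    simp only [scaledArgs, scaledXiList, List.mem_append, List.mem_flatMap, List.mem_ofFn,
      List.mem_replicate] at hq
    rcases hq with (⟨j, rfl⟩ | ⟨j, -, -, rfl⟩) | ⟨j, -, -, rfl⟩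
    · simp
    · exact hxi j
    · exact hxi j
  rcases lt_or_ge i (scaledArgs k (-2 : ℂ) x).length with hlt | hge
  · have := hmem _ (List.getElem_mem hlt)
    rw [← List.getD_eq_getElem _ (false, 0) hlt, h] at this
    exact this hi
  · rw [List.getD_eq_default _ _ hge, hi] at h
    simp at h

/-- At `ζ = -2` the denominator vanishes only at the excluded points: there `G(x, ξ₀)` is `2 x²`,
`G(x, ξ₃)` is `2 (x + 2)²`, and the rescaled values of `G(x, ξ₁)`, `G(x, ξ₂)` are constants. -/
theorem tnDen_neg_two_ne_zero {m : ℕ} (n : ℤ) (k : Fin 4 → ℤ) (x : Fin m → ℂ)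
    (hx : Admissible k x) : tnDen n k (-2 : ℂ) x ≠ 0 := by
  rw [tnDen]
  refine mul_ne_zero (mul_ne_zero (mul_ne_zero (pow_ne_zero _ two_ne_zero) ?_) ?_) ?_
  · refine prod_ne_zero_iff.2 fun i _ => prod_ne_zero_iff.2 fun j _ => ?_
    by_cases hij : i = j
    · have : kneg k i * kpos k j = 0 := by
        rw [hij, Nat.mul_eq_zero, kneg, kpos]
        omega
      rw [this, pow_zero]
      exact one_ne_zero
    · refine pow_ne_zero _ ?_
      rw [scaledXi_neg_two]
      fin_cases i <;> fin_cases j <;>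
        first
        | exact absurd rfl hij
        | norm_num [scaledG, largeG, G]
  · refine prod_ne_zero_iff.2 fun j _ => prod_ne_zero_iff.2 fun i _ => ?_
    rw [scaledXi_neg_two]
    fin_cases i
    · by_cases h : k 0 < 0
      · have e : scaledG (-2 : ℂ) (false, x j) (false, -3) = 2 * x j ^ 2 := by
          simp only [scaledG, G, Bool.or_false, Bool.false_eq_true, if_false]
          ring
        exact pow_ne_zero _ (e ▸ mul_ne_zero two_ne_zero (pow_ne_zero _ ((hx j).1 h)))
      · have : kneg k 0 = 0 := by
          rw [kneg]
          omega
        simp [this]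
    · refine pow_ne_zero _ ?_
      norm_num [scaledG, largeG]
    · refine pow_ne_zero _ ?_
      norm_num [scaledG, largeG]
    · by_cases h : k 3 < 0
      · have e : scaledG (-2 : ℂ) (false, x j) (false, 1) = 2 * (x j + 2) ^ 2 := by
          simp only [scaledG, G, Bool.or_false, Bool.false_eq_true, if_false]
          ring
        have h2 : x j + 2 ≠ 0 := fun h0 => (hx j).2 h (eq_neg_of_add_eq_zero_left h0)
        exact pow_ne_zero _ (e ▸ mul_ne_zero two_ne_zero (pow_ne_zero _ h2))
      · have : kneg k 3 = 0 := by
          rw [kneg]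
          omega
        simp [this]
  · refine prod_ne_zero_iff.2 fun a ha => ?_
    have hne := (mem_filter.1 ha).2
    rw [neg_add_cancel, zero_mul, zero_mul, sub_zero, zero_sub]
    split_ifs with h
    · exact scaledArg_ne_zero k x _ h
    · refine neg_ne_zero.2 (scaledArg_ne_zero k x _ ?_)
      rw [Bool.not_eq_true] at h
      rw [h] at hne
      simpa using hne

/-- The numerator at `ζ = -2` does not vanish identically. -/
theorem exists_tnNum_neg_two_ne_zero {m : ℕ} (n : ℤ) (k : Fin 4 → ℤ)
    (hm : (m : ℤ) = 2 * n - ∑ j, k j) :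
    ∃ x : Fin m → ℂ, Admissible k x ∧ tnNum n k (-2 : ℂ) x ≠ 0 := by
  set N := (n + (∑ j, kneg k j : ℕ)).toNat with hN
  have hNn := toNat_add_sum_kneg n k hm
  have hk : ∀ j, k j = kpos k j - kneg k j := fun j => by
    simp only [kpos, kneg]
    omega
  have h2N : 2 * N = m + ∑ j, kpos k j + ∑ j, kneg k j := by
    zify
    rw [← hN] at hNn
    simp only [Fin.sum_univ_four, hk] at hm hNn ⊢
    push_cast at hm hNn ⊢
    linarith
  have hneg : ∀ j, 0 ≤ k j → kneg k j = 0 := fun j hj => by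
    rw [kneg]
    omega
  have hpos : ∀ j, ¬ 0 ≤ k j → kpos k j = 0 := fun j hj => by
    rw [kpos]
    omega
  have hS : smallCount m k = m + (kpos k 0 + kneg k 0 + (kpos k 3 + kneg k 3)) := by
    rw [smallCount]
    ring
  have hL : 2 * N - smallCount m k = kpos k 1 + kneg k 1 + (kpos k 2 + kneg k 2) := by
    rw [h2N, smallCount, Fin.sum_univ_four, Fin.sum_univ_four]
    omega
  have hSN : smallCount m k ≤ 2 * N := by
    rw [h2N, smallCount, Fin.sum_univ_four, Fin.sum_univ_four]
    omega
  -- since one of `k_j⁺`, `k_j⁻` is zero, `ξ_j` imposes a condition on only one side of `p`, and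
  -- the flags below select this side
  obtain ⟨x, hxbad, hx⟩ := exists_small_points ({0, -2} : Finset ℂ) m (kpos k 0 + kneg k 0)
    (kpos k 3 + kneg k 3) (decide (0 ≤ k 3)) (decide (0 ≤ k 0))
  have hx' : ∀ j, x j ≠ 0 ∧ x j ≠ -2 := fun j => by
    have := hxbad j
    simpa only [mem_insert, mem_singleton, not_or] using this
  refine ⟨x, fun j => ⟨fun _ => (hx' j).1, fun _ => (hx' j).2⟩, ?_⟩
  have hprod := newtonProd_scaledArg k (-2 : ℂ) x
  rw [← h2N, scaledXi_neg_two] at hprod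
  rw [tnNum]
  refine mul_ne_zero (pow_ne_zero _ (neg_ne_zero.2 one_ne_zero)) ?_
  refine det_scaledMatrix_ne_zero N _ _ hSN _ _ ?_ ?_
  -- the large points: zeros at `-2` and `6`, the limits of `(ζ + 2) ξ₁` and `(ζ + 2) ξ₂`
  · intro v hv
    rw [hL] at hv ⊢
    have hdvd : ∀ u : Bool, (X - C (-2)) ^ (if u then kpos k 1 else kneg k 1)
        * (X - C 6) ^ (if u then kpos k 2 else kneg k 2)
        ∣ ∑ r ∈ range (kpos k 1 + kneg k 1 + (kpos k 2 + kneg k 2)),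
          C (v r) * rowPoly (0 : ℂ) 1 (-2) N u (2 * N - 1 - r) := by
      intro u
      have := hv u
      rw [hprod] at this
      simpa [Fin.prod_univ_four] using this
    refine eq_zero_of_rowPoly_large_dvd (hL ▸ Nat.sub_le _ _) (decide (0 ≤ k 2))
      (decide (0 ≤ k 1)) v ?_ ?_
    · have h2 := dvd_of_mul_left_dvd (hdvd (decide (0 ≤ k 2)))
      refine Dvd.dvd.trans (pow_dvd_pow _ ?_) h2
      by_cases h : 0 ≤ k 2
      · simp [h, hneg 2 h]
      · simp [h, hpos 2 h]
    · have h2 := dvd_of_mul_right_dvd (hdvd (decide (0 ≤ k 1)))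
      rw [C_neg, sub_neg_eq_add] at h2
      refine Dvd.dvd.trans (pow_dvd_pow _ ?_) h2
      by_cases h : 0 ≤ k 1
      · simp [h, hneg 1 h]
      · simp [h, hpos 1 h]
  -- the small points: zeros at `-3` and `1`, the limits of `ξ₀` and `ξ₃`, and at the `x_j`
  · intro v hv
    rw [hS] at hv ⊢
    set c : ℕ → ℂ := fun i => v i * 2 ^ (N - (i + 2) / 2) with hc
    have hsum : ∀ u : Bool, ∑ i ∈ range (m + (kpos k 0 + kneg k 0 + (kpos k 3 + kneg k 3))),
        C (v i) * rowPoly (1 : ℂ) 0 (-2) N u i = C (if u then 1 else 6) *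
        ∑ i ∈ range (m + (kpos k 0 + kneg k 0 + (kpos k 3 + kneg k 3))),
          C (c i) * (if u then trigP ℂ i else trigSigmaP ℂ i) := by
      intro u
      rw [mul_sum]
      refine sum_congr rfl fun i _ => ?_
      rw [rowPoly_small, hc, C_mul, C_mul]
      ring
    have hunit : ∀ u : Bool, IsUnit (C (if u then 1 else 6 : ℂ)) := fun u =>
      isUnit_C.2 (IsUnit.mk0 _ (by split_ifs <;> norm_num))
    have hdvd : ∀ u : Bool, (if u then ∏ j, (X - C (x j)) else 1)
        * ((X - C (-3)) ^ (if u then kpos k 0 else kneg k 0)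
          * (X - C 1) ^ (if u then kpos k 3 else kneg k 3))
        ∣ ∑ i ∈ range (m + (kpos k 0 + kneg k 0 + (kpos k 3 + kneg k 3))),
          C (c i) * (if u then trigP ℂ i else trigSigmaP ℂ i) := by
      intro u
      have := hv u
      rw [hprod, hsum, (hunit u).dvd_mul_left] at this
      simpa [Fin.prod_univ_four] using this
    have hzero := hx c ?_ ?_ ?_
    · intro i hi
      exact (mul_eq_zero.1 (hzero i hi)).resolve_right (pow_ne_zero _ two_ne_zero)
    · have h2 := dvd_of_mul_left_dvd (dvd_of_mul_left_dvd (hdvd (decide (0 ≤ k 3))))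
      rw [C_1] at h2
      refine Dvd.dvd.trans (pow_dvd_pow _ ?_) h2
      by_cases h : 0 ≤ k 3
      · simp [h, hneg 3 h]
      · simp [h, hpos 3 h]
    · have h2 := dvd_of_mul_right_dvd (dvd_of_mul_left_dvd (hdvd (decide (0 ≤ k 0))))
      rw [C_neg, sub_neg_eq_add] at h2
      refine Dvd.dvd.trans (pow_dvd_pow _ ?_) h2
      by_cases h : 0 ≤ k 0
      · simp [h, hneg 0 h]
      · simp [h, hpos 0 h]
    · intro j
      have h1 := dvd_of_mul_right_dvd (hdvd true)
      simp only [if_true] at h1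
      have h2 := (dvd_prod_of_mem (fun j => X - C (x j)) (mem_univ j)).trans h1
      exact dvd_iff_isRoot.1 h2

end AtMinusTwo

end ThetaT

theorem corollary3 (n : ℤ) (k : Fin 4 → ℤ) (m : ℕ) (hm : (m : ℤ) = 2 * n - ∑ j, k j) :
    (∃ L : (Fin m → ℂ) → ℂ,
      (∀ x : Fin m → ℂ, ThetaT.Admissible k x →
        Tendsto (fun ζ : ℂ => ((ζ + 2) / 6) ^ ThetaT.trigExp n k * ThetaT.Tn n k ζ x)
          (𝓝[≠] (-2)) (𝓝 (L x))) ∧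
      ∃ x : Fin m → ℂ, ThetaT.Admissible k x ∧ L x ≠ 0) ∧
    ThetaT.TnRat m n k ≠ 0 := by
  obtain ⟨x₀, hx₀, hnum₀⟩ := ThetaT.exists_tnNum_neg_two_ne_zero n k hm
  have hden₀ := ThetaT.tnDen_neg_two_ne_zero n k x₀ hx₀
  refine ⟨⟨fun x => (6 : ℂ)⁻¹ ^ ThetaT.trigExp n k *
    (ThetaT.tnNum n k (-2 : ℂ) x / ThetaT.tnDen n k (-2 : ℂ) x), fun x hx => ?_, x₀, hx₀, ?_⟩, ?_⟩
  · have hden := ThetaT.tnDen_neg_two_ne_zero n k x hx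
    -- for fixed `x` the numerator and the denominator are polynomials in `ζ`
    have hcn : Continuous fun ζ : ℂ => ThetaT.tnNum n k ζ x := by
      have h := (ThetaT.tnNum n k (Polynomial.X : Polynomial ℂ)
        (fun j => Polynomial.C (x j))).continuous
      convert h using 2 with ζ
      have := ThetaT.map_tnNum (Polynomial.evalRingHom ζ) n k (Polynomial.X : Polynomial ℂ)
        (fun j => Polynomial.C (x j))
      simpa using this.symm
    have hcd : Continuous fun ζ : ℂ => ThetaT.tnDen n k ζ x := by
      have h := (ThetaT.tnDen n k (Polynomial.X : Polynomial ℂ)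
        (fun j => Polynomial.C (x j))).continuous
      convert h using 2 with ζ
      have := ThetaT.map_tnDen (Polynomial.evalRingHom ζ) n k (Polynomial.X : Polynomial ℂ)
        (fun j => Polynomial.C (x j))
      simpa using this.symm
    have hlim := (((hcn.tendsto (-2)).div (hcd.tendsto (-2)) hden).const_mul
      ((6 : ℂ)⁻¹ ^ ThetaT.trigExp n k)).mono_left (nhdsWithin_le_nhds (s := {-2}ᶜ))
    refine hlim.congr' ?_
    have hev : ∀ᶠ ζ in 𝓝[≠] (-2 : ℂ), ThetaT.tnDen n k ζ x ≠ 0 :=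
      ((hcd.tendsto (-2)).eventually_ne hden).filter_mono nhdsWithin_le_nhds
    filter_upwards [hev, self_mem_nhdsWithin] with ζ h1 h2
    have hζ : ζ + 2 ≠ 0 := fun h => h2 (eq_neg_of_add_eq_zero_left h)
    have := zpow_ne_zero (ThetaT.trigExp n k) hζ
    rw [Pi.div_apply, ThetaT.Tn_eq n k hm ζ hζ x h1, div_eq_mul_inv (ζ + 2), mul_zpow, zpow_neg]
    field_simp
  · exact mul_ne_zero (zpow_ne_zero _ (by norm_num)) (div_ne_zero hnum₀ hden₀)
  -- numerator and denominator are nonzero polynomials, as their values at `(-2, x₀)` are nonzero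
  · set Z : MvPolynomial (Option (Fin m)) ℂ := MvPolynomial.X none with hZ
    set x : Fin m → MvPolynomial (Option (Fin m)) ℂ := fun j => MvPolynomial.X (some j) with hx
    set ev : MvPolynomial (Option (Fin m)) ℂ →+* ℂ :=
      MvPolynomial.eval fun o => o.elim (-2) x₀ with hev
    have hinj := IsFractionRing.injective (MvPolynomial (Option (Fin m)) ℂ) (ThetaT.RatField m)
    have hevZ : ev Z = -2 := by simp [hev, hZ]
    have hevx : (fun j => ev (x j)) = x₀ := by
      funext j
      simp [hev, hx]
    have hnum : ThetaT.tnNum n k Z x ≠ 0 := fun h => hnum₀ (by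
      rw [← hevZ, ← hevx, ← ThetaT.map_tnNum, h, map_zero])
    have hden : ThetaT.tnDen n k Z x ≠ 0 := fun h => hden₀ (by
      rw [← hevZ, ← hevx, ← ThetaT.map_tnDen, h, map_zero])
    have hZ2 : Z + 2 ≠ 0 := fun h => by
      have := congrArg (MvPolynomial.eval fun _ => (0 : ℂ)) h
      rw [map_add, hZ, MvPolynomial.eval_X, map_ofNat, map_zero] at this
      norm_num at this
    have hne : ∀ {p : MvPolynomial (Option (Fin m)) ℂ}, p ≠ 0 →
        algebraMap _ (ThetaT.RatField m) p ≠ 0 := fun hp =>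
      (map_ne_zero_iff _ hinj).2 hp
    have hnum' := hne hnum
    have hden' := hne hden
    have hZ' := hne hZ2
    rw [ThetaT.map_tnNum] at hnum'
    rw [ThetaT.map_tnDen] at hden'
    rw [map_add, map_ofNat] at hZ'
    rw [ThetaT.TnRat, ThetaT.Tn_eq n k hm _ hZ' _ hden']
    exact mul_ne_zero (zpow_ne_zero _ hZ') (div_ne_zero hnum' hden')
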